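/- Let $n\ge 2$ and consider the memoryless channel $\underline Y=\underline X+\underline Z$ on $\mathbb R^n$, where $\underline Z$ is independent of $\underline X$ and has independent standard Gaussian entries, under the amplitude constraint $\|\underline X\|\le A$ with $A>0$. All logarithms are natural. Let $$C(A)=\lim_{m\to\infty}\frac1m\sup I(\underline X^m;\underline Y^m)$$ be its capacity, the supremum being over all laws of $\underline X^m=(\underline X_1,\dots,\underline X_m)$ with $\|\underline X_i\|\le A$ almost surely for every $i$. Let $\mathrm{Vol}(A)$ be the volume of the ball of radius $A$ in $\mathbb R^n$, $H_e(\beta)=-\beta\log\beta-(1-\beta)\log(1-\beta)$, and $$k_n(A)=\frac{2}{2^{n/2}\Gamma(n/2)}\int_A^\infty e^{-(r-A)^2/2}r^{n-1}\,dr,$$ $$\tilde I_n(x)=\frac{2}{2^{(n-1)/2}\,\Gamma\!\left(\frac{n-1}{2}\right)\sqrt{2\pi}}\int_0^\pi e^{x\cos\phi}(\sin\phi)^{n-2}\,d\phi,$$ $$Q_n(x,A)=\int_A^\infty e^{-(z^2+x^2)/2}\,\tilde I_n(zx)\,z^{n-1}\,dz,$$ $$\tilde g_n(x,A)=\int_A^\infty\left(\frac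 n2-\frac{(z-A)^2}{2}\right)e^{-(z^2+x^2)/2}\,\tilde I_n(zx)\,z^{n-1}\,dz.$$ Consider the condition $$1-Q_n(A,A)\ \ge\ \frac{\mathrm{Vol}(A)}{(2\pi)^{n/2}k_n(A)+\mathrm{Vol}(A)}.\qquad(*)$$ There is a smallest $A^*_n>0$ for which equality holds in $(*)$, and $(*)$ holds for all $0<A\le A^*_n$. For $P>0$ put $\beta_n(P)=1-Q_n(\sqrt{nP},\sqrt{nP})$. Then, for every $P>0$ such that $(*)$ holds for $A=\sqrt{nP}$, and in particular for every $0<P\le P^*_n:=(A^*_n)^2/n$, $$C(\sqrt{nP})\le(1-\beta_n(P))\log k_n(\sqrt{nP})+\beta_n(P)\log\frac{\mathrm{Vol}(\sqrt{nP})}{(2\pi e)^{n/2}}+H_e(\beta_n(P))-\tilde g_n(\sqrt{nP},\sqrt{nP}).$$ -/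

import Mathlib

open MeasureTheory ProbabilityTheory Filter Topology
open scoped ENNReal

noncomputable section

/-- `Vol(r)`, the volume of the ball of radius `r` in `ℝⁿ`. -/
def ballVol (n : ℕ) (r : ℝ) : ℝ :=
  volume.real (Metric.closedBall (0 : EuclideanSpace ℝ (Fin n)) r)

/-- `kₙ(A) = 2 / (2^{n/2} Γ(n/2)) ∫_A^∞ exp(-(r-A)²/2) r^{n-1} dr`. -/
def kConst (n : ℕ) (A : ℝ) : ℝ :=
  2 / ((2 : ℝ) ^ ((n : ℝ) / 2) * Real.Gamma ((n : ℝ) / 2)) *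
    ∫ r in Set.Ioi A, Real.exp (-(r - A) ^ 2 / 2) * r ^ (n - 1)

/-- `Ĩₙ(x) = 2 / (2^{(n-1)/2} Γ((n-1)/2) √(2π)) ∫₀^π exp(x cos φ) (sin φ)^{n-2} dφ`, for `n ≥ 2`. -/
def besselTilde (n : ℕ) (x : ℝ) : ℝ :=
  2 / ((2 : ℝ) ^ (((n : ℝ) - 1) / 2) * Real.Gamma (((n : ℝ) - 1) / 2) * √(2 * Real.pi)) *
    ∫ φ in (0 : ℝ)..Real.pi, Real.exp (x * Real.cos φ) * Real.sin φ ^ (n - 2)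

/-- `Qₙ(x, A) = ∫_A^∞ exp(-(z²+x²)/2) Ĩₙ(zx) z^{n-1} dz`, for `n ≥ 2`. -/
def marcumQ (n : ℕ) (x A : ℝ) : ℝ :=
  ∫ z in Set.Ioi A, Real.exp (-(z ^ 2 + x ^ 2) / 2) * besselTilde n (z * x) * z ^ (n - 1)

/-- `g̃ₙ(x, A) = ∫_A^∞ (n/2 - (z-A)²/2) exp(-(z²+x²)/2) Ĩₙ(zx) z^{n-1} dz`, for `n ≥ 2`. -/
def gTilde (n : ℕ) (x A : ℝ) : ℝ :=
  ∫ z in Set.Ioi A, ((n : ℝ) / 2 - (z - A) ^ 2 / 2) *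
    (Real.exp (-(z ^ 2 + x ^ 2) / 2) * besselTilde n (z * x) * z ^ (n - 1))

/-- The law of `m` independent copies of the `n`-dimensional noise, each with independent
standard Gaussian coordinates. -/
def blockNoise (n m : ℕ) : Measure (Fin m → EuclideanSpace ℝ (Fin n)) :=
  Measure.pi fun _ => stdGaussian (EuclideanSpace ℝ (Fin n))

/-- The mutual information `I(X^m; Y^m)` in nats, where `X^m` has law `μ`, `Y^m = X^m + Z^m`, and
`Z^m` is the noise, independent of `X^m`: the divergence of the joint law of `(X^m, Y^m)` from
the product of its marginals. -/
def blockMutualInfo (n m : ℕ) (μ : Measure (Fin m → EuclideanSpace ℝ (Fin n))) : ℝ≥0∞ :=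
  InformationTheory.klDiv
    ((μ.prod (blockNoise n m)).map fun p => (p.1, p.1 + p.2))
    (μ.prod ((μ.prod (blockNoise n m)).map fun p => p.1 + p.2))

/-- `sup I(X^m; Y^m)` over all input laws with `‖X_i‖ ≤ A` almost surely for every `i`. -/
def blockMaxInfo (n m : ℕ) (A : ℝ) : ℝ≥0∞ :=
  ⨆ (μ : Measure (Fin m → EuclideanSpace ℝ (Fin n))) (_ : IsProbabilityMeasure μ)
    (_ : ∀ᵐ x ∂μ, ∀ i, ‖x i‖ ≤ A), blockMutualInfo n m μ

/-- The capacity `C = lim_m (1/m) sup I(X^m; Y^m)` in nats per `n`-dimensional symbol under the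
constraint `‖X‖ ≤ A`. The suprema are superadditive in `m`, so the limit exists and is
the limit superior, which needs no existence proof. -/
def capacity (n : ℕ) (A : ℝ) : ℝ≥0∞ :=
  limsup (fun m : ℕ => (m : ℝ≥0∞)⁻¹ * blockMaxInfo n m A) atTop

/-- `Vol(A) / ((2π)^{n/2} kₙ(A) + Vol(A))`. -/
def betaLower (n : ℕ) (A : ℝ) : ℝ :=
  ballVol n A / ((2 * Real.pi) ^ ((n : ℝ) / 2) * kConst n A + ballVol n A)

/-- `βₙ(P) = 1 - Qₙ(√(nP), √(nP))`. -/
def betaN (n : ℕ) (P : ℝ) : ℝ := 1 - marcumQ n √(n * P) √(n * P)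

/-- `(1-β) log kₙ(A) + β log(Vol(A)/(2πe)^{n/2}) + H_e(β) - g̃ₙ(A, A)`
with `A = √(nP)` and `β = βₙ(P)`. -/
def refinedBound (n : ℕ) (P : ℝ) : ℝ :=
  (1 - betaN n P) * Real.log (kConst n √(n * P))
    + betaN n P *
      Real.log (ballVol n √(n * P) / (2 * Real.pi * Real.exp 1) ^ ((n : ℝ) / 2))
    + Real.binEntropy (betaN n P) - gTilde n √(n * P) √(n * P)

end

/-! Mutual information is at most the divergence of the joint law from `μ × R` for any output law
`R` (`klDiv_prod_snd_le`). Take `R` to be an `m`-fold product of one radial law with density `exp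
(-f ‖y‖)`. The divergence then splits over letters, and each letter contributes the mean of `E f ‖x
+ Z‖ - (n/2) log (2πe)`. Bounding this for every `‖x‖ ≤ A` bounds the capacity, uniformly in `m`
(`capacity_le`).

The radial law puts mass `b` uniformly on the ball of radius `A` and mass `1 - b` outside it, with
density proportional to `exp (-(‖y‖ - A)² / 2)`; the constant `kConst` normalizes the outer part.
With `b = 1 - Q(A, A)`, condition (*) says exactly that the density does not jump up at the sphere,
so `f` is monotone. By `integral_norm_add_le` the worst input then has norm `A`, where the
expectation is explicit: `normDensity` is the density of `‖a + Z‖`, so `marcumQ` and `gTilde` are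
expectations over the event `‖a + Z‖ > A`.

For the threshold, (*) is strict near `0`, since `kConst` is at least `1 + c A` while the Gaussian
loss on the ball is only `exp (-2 A²)`. It fails for large `A`, where its left side is at most `1/2`
and its right side exceeds `1/2`. Continuity gives a least crossing. -/

/-! ### Product densities and the standard Gaussian law -/

theorem lintegral_fin_nat_prod_eq_prod {n : ℕ} {E : Type*} {mE : MeasurableSpace E}
    {μ : Fin n → Measure E} [∀ i, SigmaFinite (μ i)]
    {f : Fin n → E → ℝ≥0∞} (hf : ∀ i, Measurable (f i)) :
    ∫⁻ x : Fin n → E, ∏ i, f i (x i) ∂(Measure.pi μ) = ∏ i, ∫⁻ x, f i x ∂(μ i) := by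
  induction n with
  | zero => simp
  | succ n n_ih =>
    calc
      _ = ∫⁻ x : E × (Fin n → E), f 0 x.1 * ∏ i : Fin n, f (Fin.succ i) (x.2 i)
            ∂((μ 0).prod (Measure.pi (fun i ↦ μ i.succ))) := by
        rw [← ((measurePreserving_piFinSuccAbove μ 0).symm).lintegral_comp_emb
          (MeasurableEquiv.measurableEmbedding _)]
        simp_rw [MeasurableEquiv.piFinSuccAbove_symm_apply, Fin.insertNthEquiv,
          Fin.prod_univ_succ, Fin.insertNth_zero, Equiv.coe_fn_mk, Fin.cons_succ,
          Fin.zero_succAbove, Fin.cons_zero]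
        rfl
      _ = (∫⁻ x, f 0 x ∂μ 0) * ∏ i : Fin n, ∫⁻ x, f (Fin.succ i) x ∂(μ i.succ) := by
        rw [← n_ih (fun i ↦ hf _), ← lintegral_prod_mul (hf 0).aemeasurable]
        exact (Finset.measurable_prod _ fun i _ ↦
          (hf _).comp (measurable_pi_apply i)).aemeasurable
      _ = ∏ i, ∫⁻ x, f i x ∂(μ i) := by rw [Fin.prod_univ_succ]

theorem pi_withDensity {n : ℕ} {E : Type*} {mE : MeasurableSpace E}
    {μ : Fin n → Measure E} [∀ i, SigmaFinite (μ i)]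
    {f : Fin n → E → ℝ≥0∞} (hf : ∀ i, Measurable (f i))
    [∀ i, SigmaFinite ((μ i).withDensity (f i))] :
    Measure.pi (fun i ↦ (μ i).withDensity (f i)) =
      (Measure.pi μ).withDensity (fun x ↦ ∏ i, f i (x i)) := by
  refine Measure.pi_eq fun s hs ↦ ?_
  rw [withDensity_apply _ (MeasurableSet.univ_pi hs), Measure.restrict_pi_pi,
    lintegral_fin_nat_prod_eq_prod hf]
  exact Finset.prod_congr rfl fun i _ ↦ (withDensity_apply _ (hs i)).symm

/-- The density of the standard Gaussian distribution on `ℝⁿ`. -/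
noncomputable def gaussDensity (n : ℕ) (z : EuclideanSpace ℝ (Fin n)) : ℝ :=
  (2 * Real.pi) ^ (-(n : ℝ) / 2) * Real.exp (-‖z‖ ^ 2 / 2)

theorem gaussDensity_pos (n : ℕ) (z : EuclideanSpace ℝ (Fin n)) : 0 < gaussDensity n z := by
  unfold gaussDensity; positivity

@[fun_prop]
theorem continuous_gaussDensity (n : ℕ) : Continuous (gaussDensity n) := by
  unfold gaussDensity; fun_prop

theorem measurable_gaussDensity (n : ℕ) : Measurable (gaussDensity n) :=
  (continuous_gaussDensity n).measurable

theorem prod_gaussianPDFReal (n : ℕ) (z : EuclideanSpace ℝ (Fin n)) :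
    ∏ i, gaussianPDFReal 0 1 (z i) = gaussDensity n z := by
  simp only [gaussianPDFReal, NNReal.coe_one, mul_one, sub_zero, Finset.prod_mul_distrib,
    Finset.prod_const, Finset.card_univ, Fintype.card_fin, gaussDensity, ← Real.exp_sum]
  congr 1
  · rw [Real.sqrt_eq_rpow, ← Real.rpow_neg (by positivity), ← Real.rpow_mul_natCast (by positivity)]
    congr 1; ring
  · rw [EuclideanSpace.real_norm_sq_eq, ← Finset.sum_div, Finset.sum_neg_distrib]

theorem stdGaussian_eq_withDensity (n : ℕ) :
    stdGaussian (EuclideanSpace ℝ (Fin n)) =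
      volume.withDensity (fun z ↦ ENNReal.ofReal (gaussDensity n z)) := by
  have h1 : (Measure.pi (fun _ : Fin n ↦ gaussianReal 0 1)) =
      (volume : Measure (Fin n → ℝ)).withDensity
        (fun x ↦ ∏ i, gaussianPDF 0 1 (x i)) := by
    simp_rw [gaussianReal_of_var_ne_zero 0 one_ne_zero]
    have : SigmaFinite ((volume : Measure ℝ).withDensity (gaussianPDF 0 1)) := by
      rw [← gaussianReal_of_var_ne_zero 0 one_ne_zero]; infer_instance
    exact pi_withDensity (fun _ ↦ measurable_gaussianPDF _ _)
  rw [← map_pi_eq_stdGaussian, h1]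
  ext s hs
  have hm := PiLp.volume_preserving_toLp (Fin n)
  rw [Measure.map_apply hm.measurable hs, withDensity_apply _ (hm.measurable hs),
    withDensity_apply _ hs, ← hm.setLIntegral_comp_preimage hs
      (measurable_gaussDensity n).ennreal_ofReal]
  refine lintegral_congr fun x ↦ ?_
  rw [← prod_gaussianPDFReal, ENNReal.ofReal_prod_of_nonneg]
  · rfl
  · intro i _; exact gaussianPDFReal_nonneg _ _ _

theorem integrable_norm_sq_stdGaussian (n : ℕ) :
    Integrable (fun z ↦ ‖z‖ ^ 2) (stdGaussian (EuclideanSpace ℝ (Fin n))) := by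
  have := (IsGaussian.memLp_two_id (μ := stdGaussian (EuclideanSpace ℝ (Fin n))))
  exact (memLp_two_iff_integrable_sq_norm this.1).1 this

theorem integral_norm_sq_stdGaussian (n : ℕ) :
    ∫ z, ‖z‖ ^ 2 ∂(stdGaussian (EuclideanSpace ℝ (Fin n))) = n := by
  rw [← map_pi_eq_stdGaussian, integral_map (by fun_prop) (by fun_prop)]
  simp_rw [EuclideanSpace.real_norm_sq_eq]
  have h2 : MemLp id 2 (gaussianReal 0 1) := IsGaussian.memLp_two_id
  have hint : Integrable (fun x : ℝ ↦ x ^ 2) (gaussianReal 0 1) := h2.integrable_sq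
  rw [integral_finsetSum]
  · have : ∀ i : Fin n, ∫ x : Fin n → ℝ, x i ^ 2 ∂(Measure.pi fun _ ↦ gaussianReal 0 1) = 1 := by
      intro i
      rw [integral_comp_eval (μ := fun _ : Fin n ↦ gaussianReal 0 1) (f := fun x : ℝ ↦ x ^ 2)
        (by fun_prop)]
      have := variance_of_integral_eq_zero (μ := gaussianReal 0 1) (X := id)
        (by fun_prop) (by simp)
      rw [variance_id_gaussianReal] at this
      simpa using this.symm
    simp [this]
  · intro i _
    exact integrable_comp_eval (μ := fun _ : Fin n ↦ gaussianReal 0 1) hint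

/-! ### Divergence and the choice of output law -/

/-- Data processing, applied to the map and to its inverse. -/
theorem klDiv_map_equiv {α β : Type*} [MeasurableSpace α] [MeasurableSpace β]
    (e : α ≃ᵐ β) (μ ν : Measure α) [IsFiniteMeasure μ] [IsFiniteMeasure ν] :
    InformationTheory.klDiv (μ.map e) (ν.map e) = InformationTheory.klDiv μ ν := by
  refine le_antisymm (InformationTheory.klDiv_map_le _ _ e.measurable) ?_
  have := InformationTheory.klDiv_map_le (μ.map e) (ν.map e) e.symm.measurable
  simpa using this

/-- Among all product laws `μ × Q`, the divergence from a joint law with first marginal `μ`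
is minimized when `Q` is the second marginal. -/
theorem klDiv_prod_snd_le {α β : Type*} [MeasurableSpace α] [StandardBorelSpace α] [Nonempty α]
    [MeasurableSpace β] (J : Measure (α × β)) [IsProbabilityMeasure J] (μ : Measure α)
    [IsProbabilityMeasure μ] (Q : Measure β) [IsProbabilityMeasure Q] :
    InformationTheory.klDiv J (μ.prod J.snd) ≤ InformationTheory.klDiv J (μ.prod Q) := by
  -- Disintegrating over the output makes the chain rule split off `klDiv J.snd R`; the remaining
  -- conditional term does not involve `R`, and it is the whole divergence when `R = J.snd`.
  have key : ∀ R : Measure β, IsProbabilityMeasure R →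
      InformationTheory.klDiv J (μ.prod R) =
        InformationTheory.klDiv (J.snd ⊗ₘ (J.map Prod.swap).condKernel)
          (R ⊗ₘ Kernel.const β μ) := by
    intro R _
    rw [Measure.compProd_const, ← klDiv_map_equiv MeasurableEquiv.prodComm]
    congr 1
    · have := (J.map Prod.swap).disintegrate (J.map Prod.swap).condKernel
      rw [Measure.fst_map_swap] at this
      exact this.symm
    · exact Measure.prod_swap
  rw [key _ inferInstance, key Q inferInstance,
    InformationTheory.klDiv_compProd_eq_add J.snd Q]
  exact le_add_self

/-! ### The dual capacity bound for a radial output law -/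

section DualBound

variable {n : ℕ} {f : ℝ → ℝ}

/-- The radial law on `ℝⁿ` with density `exp (-f ‖y‖)`. -/
noncomputable def radialLaw (n : ℕ) (f : ℝ → ℝ) : Measure (EuclideanSpace ℝ (Fin n)) :=
  volume.withDensity fun y ↦ ENNReal.ofReal (Real.exp (-f ‖y‖))

/-- The ratio of the Gaussian density centred at `x` to the density `exp (-f ‖y‖)`. -/
noncomputable def radialRatio (n : ℕ) (f : ℝ → ℝ) (x y : EuclideanSpace ℝ (Fin n)) : ℝ :=
  gaussDensity n (y - x) * Real.exp (f ‖y‖)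

theorem radialRatio_pos (x y : EuclideanSpace ℝ (Fin n)) : 0 < radialRatio n f x y :=
  mul_pos (gaussDensity_pos _ _) (Real.exp_pos _)

theorem measurable_radialRatio (hf : Measurable f) :
    Measurable fun p : EuclideanSpace ℝ (Fin n) × EuclideanSpace ℝ (Fin n) ↦
      radialRatio n f p.1 p.2 := by
  unfold radialRatio
  have := measurable_gaussDensity n
  fun_prop

theorem measurable_radialRatio_eval (hf : Measurable f) {m : ℕ} (i : Fin m) :
    Measurable fun p : (Fin m → EuclideanSpace ℝ (Fin n)) × (Fin m → EuclideanSpace ℝ (Fin n)) ↦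
      radialRatio n f (p.1 i) (p.2 i) := by
  unfold radialRatio
  have := measurable_gaussDensity n
  fun_prop

theorem measurable_prod_radialRatio (hf : Measurable f) (m : ℕ) :
    Measurable fun p : (Fin m → EuclideanSpace ℝ (Fin n)) × (Fin m → EuclideanSpace ℝ (Fin n)) ↦
      ∏ i, ENNReal.ofReal (radialRatio n f (p.1 i) (p.2 i)) :=
  Finset.measurable_prod _ fun i _ ↦ (measurable_radialRatio_eval hf i).ennreal_ofReal

theorem log_radialRatio (x y : EuclideanSpace ℝ (Fin n)) :
    Real.log (radialRatio n f x y) =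
      -(n : ℝ) / 2 * Real.log (2 * Real.pi) - ‖y - x‖ ^ 2 / 2 + f ‖y‖ := by
  unfold radialRatio gaussDensity
  rw [Real.log_mul (by positivity) (by positivity), Real.log_mul (by positivity) (by positivity),
    Real.log_exp, Real.log_exp, Real.log_rpow (by positivity)]
  ring

theorem map_add_stdGaussian (x : EuclideanSpace ℝ (Fin n)) :
    (stdGaussian (EuclideanSpace ℝ (Fin n))).map (x + ·) =
      volume.withDensity fun y ↦ ENNReal.ofReal (gaussDensity n (y - x)) := by
  ext s hs
  have hm := measurePreserving_add_left (volume : Measure (EuclideanSpace ℝ (Fin n))) x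
  have hg : Measurable fun y ↦ ENNReal.ofReal (gaussDensity n (y - x)) := by
    have := measurable_gaussDensity n
    fun_prop
  rw [stdGaussian_eq_withDensity, Measure.map_apply hm.measurable hs,
    withDensity_apply _ (hm.measurable hs), withDensity_apply _ hs,
    ← hm.setLIntegral_comp_preimage hs hg]
  simp

theorem map_add_stdGaussian_eq_radialLaw (hf : Measurable f) (x : EuclideanSpace ℝ (Fin n)) :
    (stdGaussian (EuclideanSpace ℝ (Fin n))).map (x + ·) =
      (radialLaw n f).withDensity fun y ↦ ENNReal.ofReal (radialRatio n f x y) := by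
  have h1 : Measurable fun y : EuclideanSpace ℝ (Fin n) ↦
    ENNReal.ofReal (Real.exp (-f ‖y‖)) := by fun_prop
  have h2 : Measurable fun y ↦ ENNReal.ofReal (radialRatio n f x y) :=
    ((measurable_radialRatio hf).comp measurable_prodMk_left).ennreal_ofReal
  rw [map_add_stdGaussian, radialLaw, ← withDensity_mul _ h1 h2]
  congr 1
  ext y
  rw [Pi.mul_apply, ← ENNReal.ofReal_mul (Real.exp_pos _).le, radialRatio, mul_left_comm,
    ← Real.exp_add, neg_add_cancel, Real.exp_zero, mul_one]

theorem map_add_blockNoise (hf : Measurable f) [IsProbabilityMeasure (radialLaw n f)] {m : ℕ}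
    (x : Fin m → EuclideanSpace ℝ (Fin n)) :
    (blockNoise n m).map (x + ·) =
      (Measure.pi fun _ : Fin m ↦ radialLaw n f).withDensity
        fun y ↦ ∏ i, ENNReal.ofReal (radialRatio n f (x i) (y i)) := by
  -- `pi_withDensity` needs σ-finite factors; each one is a translated Gaussian.
  have hsf : ∀ i, IsProbabilityMeasure ((radialLaw n f).withDensity
      fun y ↦ ENNReal.ofReal (radialRatio n f (x i) y)) := by
    intro i
    rw [← map_add_stdGaussian_eq_radialLaw hf]
    exact Measure.isProbabilityMeasure_map (by fun_prop)
  rw [← pi_withDensity (μ := fun _ : Fin m ↦ radialLaw n f)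
    (f := fun i y ↦ ENNReal.ofReal (radialRatio n f (x i) y))
    (fun i ↦ ((measurable_radialRatio hf).comp measurable_prodMk_left).ennreal_ofReal)]
  simp_rw [← map_add_stdGaussian_eq_radialLaw hf]
  exact Measure.pi_map_pi (μ := fun _ : Fin m ↦ stdGaussian (EuclideanSpace ℝ (Fin n)))
    (f := fun i y ↦ x i + y) (fun i ↦ by fun_prop)

instance (m : ℕ) : IsProbabilityMeasure (blockNoise n m) := by
  unfold blockNoise; infer_instance

/-- The joint law of input and output of the block channel. -/
noncomputable def jointLaw (n m : ℕ) (μ : Measure (Fin m → EuclideanSpace ℝ (Fin n))) :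
    Measure ((Fin m → EuclideanSpace ℝ (Fin n)) × (Fin m → EuclideanSpace ℝ (Fin n))) :=
  (μ.prod (blockNoise n m)).map fun p => (p.1, p.1 + p.2)

instance {m : ℕ} (μ : Measure (Fin m → EuclideanSpace ℝ (Fin n))) [IsProbabilityMeasure μ] :
    IsProbabilityMeasure (jointLaw n m μ) :=
  Measure.isProbabilityMeasure_map (by fun_prop)

theorem jointLaw_eq_withDensity (hf : Measurable f) [IsProbabilityMeasure (radialLaw n f)] {m : ℕ}
    (μ : Measure (Fin m → EuclideanSpace ℝ (Fin n))) [IsProbabilityMeasure μ] :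
    jointLaw n m μ = (μ.prod (Measure.pi fun _ : Fin m ↦ radialLaw n f)).withDensity
      fun p ↦ ∏ i, ENNReal.ofReal (radialRatio n f (p.1 i) (p.2 i)) := by
  have hF := measurable_prod_radialRatio (n := n) hf m
  ext s hs
  rw [jointLaw, Measure.map_apply (by fun_prop) hs, Measure.prod_apply (by measurability),
    withDensity_apply _ hs, ← lintegral_indicator hs, lintegral_prod _
      (hF.indicator hs).aemeasurable]
  refine lintegral_congr fun x ↦ ?_
  have hsx : MeasurableSet (Prod.mk x ⁻¹' s) := measurable_prodMk_left hs
  have := congrArg (fun ν : Measure _ ↦ ν (Prod.mk x ⁻¹' s)) (map_add_blockNoise hf x)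
  rw [Measure.map_apply (by fun_prop) hsx, withDensity_apply _ hsx,
    ← lintegral_indicator hsx] at this
  exact this

theorem llr_jointLaw (hf : Measurable f) [IsProbabilityMeasure (radialLaw n f)] {m : ℕ}
    (μ : Measure (Fin m → EuclideanSpace ℝ (Fin n))) [IsProbabilityMeasure μ] :
    jointLaw n m μ ≪ μ.prod (Measure.pi fun _ : Fin m ↦ radialLaw n f) ∧
    llr (jointLaw n m μ) (μ.prod (Measure.pi fun _ : Fin m ↦ radialLaw n f))
      =ᵐ[jointLaw n m μ] fun p ↦ ∑ i, Real.log (radialRatio n f (p.1 i) (p.2 i)) := by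
  have hF := measurable_prod_radialRatio (n := n) hf m
  have hac : jointLaw n m μ ≪ μ.prod (Measure.pi fun _ : Fin m ↦ radialLaw n f) := by
    rw [jointLaw_eq_withDensity hf]
    exact withDensity_absolutelyContinuous _ _
  refine ⟨hac, ?_⟩
  have h := Measure.rnDeriv_withDensity (μ.prod (Measure.pi fun _ : Fin m ↦ radialLaw n f)) hF
  rw [← jointLaw_eq_withDensity hf] at h
  filter_upwards [hac.ae_le h] with p hp
  rw [llr, hp, ← ENNReal.ofReal_prod_of_nonneg (fun i _ ↦ (radialRatio_pos _ _).le),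
    ENNReal.toReal_ofReal (Finset.prod_nonneg fun i _ ↦ (radialRatio_pos _ _).le),
    Real.log_prod (fun i _ ↦ (radialRatio_pos _ _).ne')]

/-- A majorant uniform over the ball of inputs, integrable because the noise has a second moment. -/
theorem abs_comp_norm_add_le {C A : ℝ} (hC : ∀ r, |f r| ≤ C * (1 + r ^ 2))
    {x z : EuclideanSpace ℝ (Fin n)} (hx : ‖x‖ ≤ A) :
    |f ‖x + z‖| ≤ C * (1 + 2 * A ^ 2) + 2 * C * ‖z‖ ^ 2 := by
  have hC0 : 0 ≤ C := by have := (abs_nonneg _).trans (hC 0); simpa using this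
  have h1 : ‖x + z‖ ^ 2 ≤ 2 * A ^ 2 + 2 * ‖z‖ ^ 2 := by
    have h2 : ‖x + z‖ ^ 2 ≤ (‖x‖ + ‖z‖) ^ 2 := by gcongr; exact norm_add_le _ _
    have h3 : ‖x‖ ^ 2 ≤ A ^ 2 := by gcongr
    nlinarith [sq_nonneg (‖x‖ - ‖z‖)]
  calc _ ≤ C * (1 + ‖x + z‖ ^ 2) := hC _
    _ ≤ C * (1 + (2 * A ^ 2 + 2 * ‖z‖ ^ 2)) := by gcongr
    _ = _ := by ring

theorem integrable_comp_norm_add (hf : Measurable f) {C : ℝ} (hC : ∀ r, |f r| ≤ C * (1 + r ^ 2))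
    (x : EuclideanSpace ℝ (Fin n)) :
    Integrable (fun z ↦ f ‖x + z‖) (stdGaussian (EuclideanSpace ℝ (Fin n))) := by
  refine Integrable.mono' (g := fun z ↦ C * (1 + 2 * ‖x‖ ^ 2) + 2 * C * ‖z‖ ^ 2) ?_
    (Measurable.aestronglyMeasurable (by fun_prop)) (ae_of_all _ fun z ↦ abs_comp_norm_add_le hC le_rfl)
  exact (integrable_const _).add ((integrable_norm_sq_stdGaussian n).const_mul _)

/-- The log-likelihood ratio against the product output law is a sum over letters, so its mean is at
most `m` times the worst letter. The witness `I` is that divergence; its nonnegativity is recorded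
because `ENNReal.ofReal (m * B)` alone would hide the sign of `B`. -/
theorem blockMutualInfo_le (hf : Measurable f) {C A B : ℝ} (hC : ∀ r, |f r| ≤ C * (1 + r ^ 2))
    [IsProbabilityMeasure (radialLaw n f)]
    (hB : ∀ a : EuclideanSpace ℝ (Fin n), ‖a‖ ≤ A →
      ∫ z, f ‖a + z‖ ∂(stdGaussian (EuclideanSpace ℝ (Fin n)))
        - (n : ℝ) / 2 * Real.log (2 * Real.pi * Real.exp 1) ≤ B)
    {m : ℕ} (μ : Measure (Fin m → EuclideanSpace ℝ (Fin n))) [IsProbabilityMeasure μ]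
    (hμ : ∀ᵐ x ∂μ, ∀ i, ‖x i‖ ≤ A) :
    ∃ I : ℝ, 0 ≤ I ∧ I ≤ m * B ∧ blockMutualInfo n m μ ≤ ENNReal.ofReal I := by
  obtain ⟨hac, hllr⟩ := llr_jointLaw hf μ
  set Q := μ.prod (Measure.pi fun _ : Fin m ↦ radialLaw n f)
  have hmeas : Measurable fun p : (Fin m → EuclideanSpace ℝ (Fin n)) ×
      (Fin m → EuclideanSpace ℝ (Fin n)) ↦ (p.1, p.1 + p.2) := by fun_prop
  have hnorm (i : Fin m) : Integrable
      (fun p : (Fin m → EuclideanSpace ℝ (Fin n)) × (Fin m → EuclideanSpace ℝ (Fin n)) ↦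
        ‖p.2 i‖ ^ 2) (μ.prod (blockNoise n m)) :=
    Integrable.comp_snd (f := fun z : Fin m → EuclideanSpace ℝ (Fin n) ↦ ‖z i‖ ^ 2)
      (integrable_comp_eval (μ := fun _ : Fin m ↦ stdGaussian (EuclideanSpace ℝ (Fin n)))
        (integrable_norm_sq_stdGaussian n)) _
  have hfint (i : Fin m) : Integrable
      (fun p : (Fin m → EuclideanSpace ℝ (Fin n)) × (Fin m → EuclideanSpace ℝ (Fin n)) ↦
        f ‖p.1 i + p.2 i‖) (μ.prod (blockNoise n m)) := by
    refine Integrable.mono' (g := fun p ↦ C * (1 + 2 * A ^ 2) + 2 * C * ‖p.2 i‖ ^ 2)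
      ((integrable_const _).add ((hnorm i).const_mul _))
      (Measurable.aestronglyMeasurable (by fun_prop)) ?_
    have : ∀ᵐ p ∂(μ.prod (blockNoise n m)), ∀ i, ‖p.1 i‖ ≤ A :=
      Measure.quasiMeasurePreserving_fst.ae hμ
    filter_upwards [this] with p hp
    exact abs_comp_norm_add_le hC (hp i)
  have hlog (i : Fin m) (p : (Fin m → EuclideanSpace ℝ (Fin n)) ×
      (Fin m → EuclideanSpace ℝ (Fin n))) :
      Real.log (radialRatio n f (p.1 i) ((p.1 + p.2) i)) =
      -(n : ℝ) / 2 * Real.log (2 * Real.pi) - ‖p.2 i‖ ^ 2 / 2 + f ‖p.1 i + p.2 i‖ := by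
    rw [log_radialRatio]; simp
  have hlint (i : Fin m) : Integrable
      (fun p : (Fin m → EuclideanSpace ℝ (Fin n)) × (Fin m → EuclideanSpace ℝ (Fin n)) ↦
        Real.log (radialRatio n f (p.1 i) ((p.1 + p.2) i))) (μ.prod (blockNoise n m)) := by
    simp_rw [hlog]
    exact ((integrable_const _).sub ((hnorm i).div_const _)).add (hfint i)
  have hsm : Measurable fun p : (Fin m → EuclideanSpace ℝ (Fin n)) ×
      (Fin m → EuclideanSpace ℝ (Fin n)) ↦
        ∑ i, Real.log (radialRatio n f (p.1 i) (p.2 i)) := by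
    refine Finset.measurable_sum _ fun i _ ↦ ?_
    exact (measurable_radialRatio_eval hf i).log
  have hint : Integrable (llr (jointLaw n m μ) Q) (jointLaw n m μ) := by
    rw [integrable_congr hllr, jointLaw, integrable_map_measure (hsm.aestronglyMeasurable)
      hmeas.aemeasurable]
    exact integrable_finsetSum _ fun i _ ↦ hlint i
  have h0 := InformationTheory.integral_llr_add_sub_measure_univ_nonneg hac hint
  have hkl := InformationTheory.klDiv_of_ac_of_integrable hac hint
  simp only [probReal_univ, add_sub_cancel_right] at h0 hkl
  refine ⟨_, h0, ?_, ?_⟩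
  · rw [integral_congr_ae hllr, jointLaw, integral_map hmeas.aemeasurable
      hsm.aestronglyMeasurable, integral_finsetSum _ fun i _ ↦ hlint i]
    calc _ ≤ ∑ _i : Fin m, B := Finset.sum_le_sum fun i _ ↦ ?_
      _ = m * B := by simp
    simp_rw [hlog]
    have hsub : Integrable (fun p : (Fin m → EuclideanSpace ℝ (Fin n)) ×
        (Fin m → EuclideanSpace ℝ (Fin n)) ↦
        -(n : ℝ) / 2 * Real.log (2 * Real.pi) - ‖p.2 i‖ ^ 2 / 2) (μ.prod (blockNoise n m)) :=
      (integrable_const _).sub ((hnorm i).div_const _)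
    rw [integral_add hsub (hfint i),
      integral_sub (integrable_const _) ((hnorm i).div_const _), integral_div,
      integral_prod _ (hfint i)]
    have e1 : ∫ p : (Fin m → EuclideanSpace ℝ (Fin n)) × (Fin m → EuclideanSpace ℝ (Fin n)),
        ‖p.2 i‖ ^ 2 ∂(μ.prod (blockNoise n m)) = n := by
      rw [integral_fun_snd (fun z : Fin m → EuclideanSpace ℝ (Fin n) ↦ ‖z i‖ ^ 2),
        blockNoise, integral_comp_eval
        (μ := fun _ : Fin m ↦ stdGaussian (EuclideanSpace ℝ (Fin n)))
        (f := fun z ↦ ‖z‖ ^ 2) (by fun_prop), integral_norm_sq_stdGaussian]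
      simp
    have e2 (x : Fin m → EuclideanSpace ℝ (Fin n)) :
        ∫ z, f ‖x i + z i‖ ∂(blockNoise n m) =
          ∫ z, f ‖x i + z‖ ∂(stdGaussian (EuclideanSpace ℝ (Fin n))) := by
      rw [blockNoise, integral_comp_eval
        (μ := fun _ : Fin m ↦ stdGaussian (EuclideanSpace ℝ (Fin n)))
        (f := fun z ↦ f ‖x i + z‖) (Measurable.aestronglyMeasurable (by fun_prop))]
    have e3 : ∫ x, ∫ z, f ‖x i + z i‖ ∂(blockNoise n m) ∂μ ≤
        B + (n : ℝ) / 2 * Real.log (2 * Real.pi * Real.exp 1) := by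
      calc _ ≤ ∫ _x, (B + (n : ℝ) / 2 * Real.log (2 * Real.pi * Real.exp 1)) ∂μ := by
            refine integral_mono_ae (hfint i).integral_prod_left (integrable_const _) ?_
            filter_upwards [hμ] with x hx
            simp only [e2]
            linarith [hB (x i) (hx i)]
        _ = _ := by simp
    -- The extra `1` turns into the `n / 2` coming from half the mean of `‖Z‖²`.
    have e4 : Real.log (2 * Real.pi * Real.exp 1) = Real.log (2 * Real.pi) + 1 := by
      rw [Real.log_mul (by positivity) (by positivity), Real.log_exp]
    rw [e4] at e3
    rw [e1]
    simp only [integral_const, probReal_univ, smul_eq_mul, one_mul]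
    linarith
  · rw [← hkl]
    have hsnd : (μ.prod (blockNoise n m)).map (fun p => p.1 + p.2) = (jointLaw n m μ).snd := by
      rw [Measure.snd, jointLaw, Measure.map_map measurable_snd hmeas]; rfl
    rw [blockMutualInfo, hsnd]
    exact klDiv_prod_snd_le (jointLaw n m μ) _ _

theorem capacity_le (hf : Measurable f) {C A B : ℝ} (hA : 0 ≤ A)
    (hC : ∀ r, |f r| ≤ C * (1 + r ^ 2)) [IsProbabilityMeasure (radialLaw n f)]
    (hB : ∀ a : EuclideanSpace ℝ (Fin n), ‖a‖ ≤ A →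
      ∫ z, f ‖a + z‖ ∂(stdGaussian (EuclideanSpace ℝ (Fin n)))
        - (n : ℝ) / 2 * Real.log (2 * Real.pi * Real.exp 1) ≤ B) :
    ((capacity n A : ℝ≥0∞) : EReal) ≤ (B : EReal) := by
  -- A divergence is nonnegative, so one admissible input, the point mass at `0`, forces `B ≥ 0`.
  -- Otherwise `ENNReal.ofReal B` would be truncated to `0`, which is not below `B`.
  have hB0 : 0 ≤ B := by
    obtain ⟨I, h0, h1, -⟩ := blockMutualInfo_le hf hC hB (m := 1) (Measure.dirac 0)
      (by simp [ae_dirac_eq, hA])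
    simpa using h0.trans h1
  have hcap : capacity n A ≤ ENNReal.ofReal B := by
    refine limsup_le_of_le (by isBoundedDefault) ?_
    filter_upwards [eventually_ge_atTop 1] with m hm
    have hmax : blockMaxInfo n m A ≤ m * ENNReal.ofReal B := by
      refine iSup_le fun μ ↦ iSup_le fun _ ↦ iSup_le fun hμ ↦ ?_
      obtain ⟨I, -, h1, h2⟩ := blockMutualInfo_le hf hC hB μ hμ
      refine h2.trans ((ENNReal.ofReal_le_ofReal h1).trans ?_)
      rw [ENNReal.ofReal_mul (by positivity), ENNReal.ofReal_natCast]
    calc _ ≤ (m : ℝ≥0∞)⁻¹ * (m * ENNReal.ofReal B) := by gcongr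
      _ = ENNReal.ofReal B := by
        rw [← mul_assoc, ENNReal.inv_mul_cancel (by simp; omega) (by simp), one_mul]
  calc ((capacity n A : ℝ≥0∞) : EReal) ≤ ((ENNReal.ofReal B : ℝ≥0∞) : EReal) := by
        exact_mod_cast hcap
    _ = (B : EReal) := by rw [EReal.coe_ennreal_ofReal, max_eq_left hB0]

end DualBound

/-! ### Expected energy increases with the norm of the input -/

section Monotonicity

variable {n : ℕ}

theorem integral_add_stdGaussian {g : EuclideanSpace ℝ (Fin n) → ℝ} (hg : Measurable g)
    (a : EuclideanSpace ℝ (Fin n)) :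
    ∫ z, g (a + z) ∂(stdGaussian (EuclideanSpace ℝ (Fin n))) =
      ∫ w, gaussDensity n (w - a) * g w := by
  have hm : Measurable fun w ↦ ENNReal.ofReal (gaussDensity n (w - a)) := by fun_prop
  rw [← integral_map (φ := fun z ↦ a + z) (by fun_prop) hg.aestronglyMeasurable,
    map_add_stdGaussian, integral_withDensity_eq_integral_toReal_smul hm (by simp)]
  simp [ENNReal.toReal_ofReal (gaussDensity_pos _ _).le]

theorem integrable_add_stdGaussian {g : EuclideanSpace ℝ (Fin n) → ℝ} (hg : Measurable g)
    (a : EuclideanSpace ℝ (Fin n)) :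
    Integrable (fun z ↦ g (a + z)) (stdGaussian (EuclideanSpace ℝ (Fin n))) ↔
      Integrable fun w ↦ gaussDensity n (w - a) * g w := by
  have hm : Measurable fun w ↦ ENNReal.ofReal (gaussDensity n (w - a)) := by fun_prop
  have := integrable_map_measure (f := fun z ↦ a + z) (g := g)
    (μ := stdGaussian (EuclideanSpace ℝ (Fin n))) hg.aestronglyMeasurable (by fun_prop)
  rw [map_add_stdGaussian, integrable_withDensity_iff_integrable_smul' hm (by simp)] at this
  simpa [ENNReal.toReal_ofReal (gaussDensity_pos _ _).le, Function.comp_def] using this.symm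

theorem exists_linearIsometryEquiv_eq {a b : EuclideanSpace ℝ (Fin n)} (h : ‖a‖ = ‖b‖) :
    ∃ U : EuclideanSpace ℝ (Fin n) ≃ₗᵢ[ℝ] EuclideanSpace ℝ (Fin n), U a = b :=
  ⟨_, Submodule.reflection_sub h⟩

/-- A reflection carries `a` to `b` and preserves both the norm and the Gaussian. -/
theorem map_norm_add_stdGaussian_congr {a b : EuclideanSpace ℝ (Fin n)} (h : ‖a‖ = ‖b‖) :
    (stdGaussian (EuclideanSpace ℝ (Fin n))).map (fun z ↦ ‖a + z‖) =
      (stdGaussian (EuclideanSpace ℝ (Fin n))).map fun z ↦ ‖b + z‖ := by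
  obtain ⟨U, rfl⟩ := exists_linearIsometryEquiv_eq h
  conv_rhs => rw [← stdGaussian_map U, Measure.map_map (by fun_prop) U.continuous.measurable]
  congr 1
  ext z
  simp [← map_add]

theorem integral_norm_add_congr {f : ℝ → ℝ} (hf : Measurable f)
    {a b : EuclideanSpace ℝ (Fin n)} (h : ‖a‖ = ‖b‖) :
    ∫ z, f ‖a + z‖ ∂(stdGaussian (EuclideanSpace ℝ (Fin n))) =
      ∫ z, f ‖b + z‖ ∂(stdGaussian (EuclideanSpace ℝ (Fin n))) := by
  rw [← integral_map (φ := fun z ↦ ‖a + z‖) (f := f) (by fun_prop) hf.aestronglyMeasurable,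
    ← integral_map (φ := fun z ↦ ‖b + z‖) (f := f) (by fun_prop) hf.aestronglyMeasurable,
    map_norm_add_stdGaussian_congr h]

theorem gaussDensity_le_gaussDensity {v w : EuclideanSpace ℝ (Fin n)} (h : ‖v‖ ^ 2 ≤ ‖w‖ ^ 2) :
    gaussDensity n w ≤ gaussDensity n v := by
  unfold gaussDensity; gcongr

theorem gaussDensity_neg (v : EuclideanSpace ℝ (Fin n)) :
    gaussDensity n (-v) = gaussDensity n v := by simp [gaussDensity]

/-- The point reflection `w ↦ (1 + t) • b - w` exchanges the centres `b` and `t • b`, so the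
difference `δ` of the two Gaussian densities is odd under it. Hence `2 ∫ δ f` is the integral of `δ
w` times the difference of `f` at `‖w‖` and at the reflected norm, and these two factors never have
opposite signs. -/
theorem integral_norm_smul_add_le {f : ℝ → ℝ} (hmono : Monotone f) {C : ℝ}
    (hC : ∀ r, |f r| ≤ C * (1 + r ^ 2)) {t : ℝ} (ht0 : 0 ≤ t) (ht1 : t ≤ 1)
    (b : EuclideanSpace ℝ (Fin n)) :
    ∫ z, f ‖t • b + z‖ ∂(stdGaussian (EuclideanSpace ℝ (Fin n))) ≤
      ∫ z, f ‖b + z‖ ∂(stdGaussian (EuclideanSpace ℝ (Fin n))) := by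
  have hf := hmono.measurable
  have hg : Measurable fun w : EuclideanSpace ℝ (Fin n) ↦ f ‖w‖ := by fun_prop
  have hi (a : EuclideanSpace ℝ (Fin n)) :=
    (integrable_add_stdGaussian hg a).1 (integrable_comp_norm_add hf hC a)
  rw [integral_add_stdGaussian hg, integral_add_stdGaussian hg]
  set δ : EuclideanSpace ℝ (Fin n) → ℝ :=
    fun w ↦ gaussDensity n (w - b) - gaussDensity n (w - t • b) with hδ
  have hδi : Integrable fun w ↦ δ w * f ‖w‖ := by
    simp only [hδ, sub_mul]
    exact (hi b).sub (hi (t • b))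
  have hsub : (∫ w, gaussDensity n (w - b) * f ‖w‖) - ∫ w, gaussDensity n (w - t • b) * f ‖w‖ =
      ∫ w, δ w * f ‖w‖ := by
    rw [← integral_sub (hi b) (hi (t • b))]
    simp only [hδ, sub_mul]
  have hanti (w) : δ ((1 + t) • b - w) = -δ w := by
    simp only [hδ]
    rw [show (1 + t) • b - w - b = -(w - t • b) by module,
      show (1 + t) • b - w - t • b = -(w - b) by module, gaussDensity_neg, gaussDensity_neg]
    ring
  have hrefl : ∫ w, δ w * f ‖w‖ = ∫ w, -(δ w * f ‖(1 + t) • b - w‖) := by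
    rw [← integral_sub_left_eq_self _ _ ((1 + t) • b)]
    simp only [hanti, neg_mul]
  have hi2 : Integrable fun w ↦ -(δ w * f ‖(1 + t) • b - w‖) := by
    have := hδi.comp_sub_left ((1 + t) • b)
    simpa only [hanti, neg_mul] using this
  have hnonneg : 0 ≤ ∫ w, (δ w * f ‖w‖ + -(δ w * f ‖(1 + t) • b - w‖)) := by
    refine integral_nonneg fun w ↦ ?_
    have e1 : ‖w - b‖ ^ 2 = ‖w‖ ^ 2 - 2 * inner ℝ w b + ‖b‖ ^ 2 := norm_sub_sq_real _ _
    have e2 : ‖w - t • b‖ ^ 2 = ‖w‖ ^ 2 - 2 * (t * inner ℝ w b) + t ^ 2 * ‖b‖ ^ 2 := by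
      rw [norm_sub_sq_real, inner_smul_right, norm_smul, mul_pow, Real.norm_eq_abs, sq_abs]
    have e3 : ‖(1 + t) • b - w‖ ^ 2 =
        ‖w‖ ^ 2 - 2 * ((1 + t) * inner ℝ w b) + (1 + t) ^ 2 * ‖b‖ ^ 2 := by
      rw [norm_sub_rev, norm_sub_sq_real, inner_smul_right, norm_smul, mul_pow, Real.norm_eq_abs,
        sq_abs]
    change 0 ≤ δ w * f ‖w‖ + -(δ w * f ‖(1 + t) • b - w‖)
    -- The hyperplane where the densities agree is also where `w` and its reflection have equal
    -- norm, so one case split fixes both signs.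
    rcases le_total ((1 + t) * ‖b‖ ^ 2) (2 * inner ℝ w b) with h | h
    · have h1 : 0 ≤ δ w := sub_nonneg.2 (gaussDensity_le_gaussDensity (by nlinarith))
      have h2 : ‖(1 + t) • b - w‖ ≤ ‖w‖ :=
        le_of_sq_le_sq (by nlinarith) (norm_nonneg _)
      nlinarith [hmono h2]
    · have h1 : δ w ≤ 0 := sub_nonpos.2 (gaussDensity_le_gaussDensity (by nlinarith))
      have h2 : ‖w‖ ≤ ‖(1 + t) • b - w‖ :=
        le_of_sq_le_sq (by nlinarith) (norm_nonneg _)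
      nlinarith [hmono h2]
  rw [integral_add hδi hi2, ← hrefl] at hnonneg
  linarith

/-- The expectation of a monotone function of `‖a + Z‖` grows with `‖a‖`. -/
theorem integral_norm_add_le {f : ℝ → ℝ} (hmono : Monotone f) {C : ℝ}
    (hC : ∀ r, |f r| ≤ C * (1 + r ^ 2)) {a b : EuclideanSpace ℝ (Fin n)} (hab : ‖a‖ ≤ ‖b‖) :
    ∫ z, f ‖a + z‖ ∂(stdGaussian (EuclideanSpace ℝ (Fin n))) ≤
      ∫ z, f ‖b + z‖ ∂(stdGaussian (EuclideanSpace ℝ (Fin n))) := by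
  -- Only the norm of `a` matters, so `a` may be moved onto the segment from `0` to `b`.
  have h : ‖a‖ = ‖(‖a‖ / ‖b‖) • b‖ := by
    rcases eq_or_ne b 0 with rfl | hb
    · simpa using hab
    · rw [norm_smul, norm_div, norm_norm, norm_norm, div_mul_cancel₀ _ (norm_ne_zero_iff.2 hb)]
  rw [integral_norm_add_congr hmono.measurable h]
  exact integral_norm_smul_add_le hmono hC (by positivity)
    (div_le_one_of_le₀ hab (norm_nonneg _)) b

end Monotonicity

/-! ### Polar coordinates and the density of `‖a + Z‖` -/

section Polar

/-- The surface area of the unit sphere in `ℝᵈ`. -/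
noncomputable def sphereArea (d : ℕ) : ℝ :=
  2 * Real.pi ^ ((d : ℝ) / 2) / Real.Gamma ((d : ℝ) / 2)

theorem sphereArea_nonneg (d : ℕ) : 0 ≤ sphereArea d := by
  unfold sphereArea
  have : 0 ≤ Real.Gamma ((d : ℝ) / 2) := Real.Gamma_nonneg_of_nonneg (by positivity)
  positivity

theorem natCast_mul_volume_real_ball {d : ℕ} (hd : 0 < d) :
    d * volume.real (Metric.ball (0 : EuclideanSpace ℝ (Fin d)) 1) = sphereArea d := by
  have : Nonempty (Fin d) := ⟨⟨0, hd⟩⟩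
  have hd' : (d : ℝ) / 2 ≠ 0 := by positivity
  rw [measureReal_def, EuclideanSpace.volume_ball]
  simp only [ENNReal.ofReal_one, one_pow, Fintype.card_fin, one_mul]
  rw [ENNReal.toReal_ofReal (by
    have := Real.Gamma_nonneg_of_nonneg (s := (d : ℝ) / 2 + 1) (by positivity)
    positivity), Real.Gamma_add_one hd', sphereArea, Real.sqrt_eq_rpow,
    ← Real.rpow_mul_natCast (by positivity)]
  have hG : Real.Gamma ((d : ℝ) / 2) ≠ 0 := (Real.Gamma_pos_of_pos (by positivity)).ne'
  rw [show (1 / 2 : ℝ) * d = d / 2 by ring]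
  field_simp

/-- Off the null set `{0}`, Lebesgue measure is the product of the sphere measure and `r ^ (d - 1)
dr`. -/
theorem lintegral_comp_norm {d : ℕ} (hd : 0 < d) {H : ℝ → ℝ≥0∞} (hH : Measurable H) :
    ∫⁻ x : EuclideanSpace ℝ (Fin d), H ‖x‖ =
      ENNReal.ofReal (sphereArea d) *
        ∫⁻ r in Set.Ioi (0 : ℝ), ENNReal.ofReal (r ^ (d - 1)) * H r := by
  have : Nonempty (Fin d) := ⟨⟨0, hd⟩⟩
  let μ : Measure (EuclideanSpace ℝ (Fin d)) := volume
  have hfin : Module.finrank ℝ (EuclideanSpace ℝ (Fin d)) = d := by simp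
  have hmp := μ.measurePreserving_homeomorphUnitSphereProd
  rw [hfin] at hmp
  have hH1 : Measurable fun r : Set.Ioi (0 : ℝ) ↦ H r := hH.comp measurable_subtype_coe
  have hH2 : Measurable fun p : Metric.sphere (0 : EuclideanSpace ℝ (Fin d)) 1 ×
      Set.Ioi (0 : ℝ) ↦ H p.2 := hH1.comp measurable_snd
  have huniv : μ.toSphere Set.univ = ENNReal.ofReal (sphereArea d) := by
    rw [← natCast_mul_volume_real_ball hd, ENNReal.ofReal_mul (by positivity),
      ENNReal.ofReal_natCast, ofReal_measureReal measure_ball_lt_top.ne, Measure.toSphere_apply_univ,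
      hfin]
  calc ∫⁻ x, H ‖x‖ ∂μ = ∫⁻ x in ({0}ᶜ : Set (EuclideanSpace ℝ (Fin d))), H ‖x‖ ∂μ := by
        rw [restrict_compl_singleton]
    _ = ∫⁻ x : ({(0)}ᶜ : Set (EuclideanSpace ℝ (Fin d))), H ‖x.1‖ ∂(μ.comap (↑)) :=
        (lintegral_subtype_comap (measurableSet_singleton _).compl (fun x ↦ H ‖x‖)).symm
    _ = ∫⁻ p, H p.2 ∂(μ.toSphere.prod (.volumeIoiPow (d - 1))) := by
        rw [← hmp.lintegral_comp hH2]
        simp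
    _ = ENNReal.ofReal (sphereArea d) * ∫⁻ r, H r ∂(Measure.volumeIoiPow (d - 1)) := by
        rw [← huniv, lintegral_prod _ hH2.aemeasurable]
        simp [mul_comm]
    _ = _ := by
        rw [Measure.volumeIoiPow, lintegral_withDensity_eq_lintegral_mul _
          (measurable_subtype_coe.pow_const _).ennreal_ofReal hH1,
          ← lintegral_subtype_comap measurableSet_Ioi]
        rfl

/-- Prepend a coordinate to a Euclidean vector. -/
def euclideanCons {d : ℕ} (p : ℝ × EuclideanSpace ℝ (Fin d)) : EuclideanSpace ℝ (Fin (d + 1)) :=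
  WithLp.toLp 2 (Fin.cons p.1 (WithLp.ofLp p.2) : Fin (d + 1) → ℝ)

theorem euclideanCons_zero {d : ℕ} (p : ℝ × EuclideanSpace ℝ (Fin d)) :
    euclideanCons p 0 = p.1 := rfl

theorem norm_sq_euclideanCons {d : ℕ} (p : ℝ × EuclideanSpace ℝ (Fin d)) :
    ‖euclideanCons p‖ ^ 2 = p.1 ^ 2 + ‖p.2‖ ^ 2 := by
  simp [EuclideanSpace.real_norm_sq_eq, euclideanCons, Fin.sum_univ_succ]

theorem norm_euclideanCons {d : ℕ} (p : ℝ × EuclideanSpace ℝ (Fin d)) :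
    ‖euclideanCons p‖ = √(p.1 ^ 2 + ‖p.2‖ ^ 2) := by
  rw [← norm_sq_euclideanCons, Real.sqrt_sq (norm_nonneg _)]

theorem measurePreserving_euclideanCons (d : ℕ) :
    MeasurePreserving (euclideanCons (d := d)) := by
  have h1 : MeasurePreserving (Prod.map id (WithLp.ofLp (p := 2) (V := Fin d → ℝ)))
      (volume : Measure (ℝ × EuclideanSpace ℝ (Fin d))) volume :=
    (MeasurePreserving.id volume).prod (PiLp.volume_preserving_ofLp (Fin d))
  have h2 := (volume_preserving_piFinSuccAbove (fun _ : Fin (d + 1) ↦ ℝ) 0).symm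
  have h := (PiLp.volume_preserving_toLp (Fin (d + 1))).comp (h2.comp h1)
  convert! h using 1
  ext p i
  simp [euclideanCons, MeasurableEquiv.piFinSuccAbove_symm_apply, Fin.insertNthEquiv]

/-- Separate the first coordinate `x`, integrate the others radially with radius `ρ`, and use planar
polar coordinates on the half-plane `ρ > 0`. The weight `ρ ^ k` and the Jacobian `r` combine to `r ^
(k + 1) * sin θ ^ k`. -/
theorem lintegral_norm_coord {k : ℕ} {G : ℝ → ℝ → ℝ≥0∞} (hG : Measurable (Function.uncurry G)) :
    ∫⁻ w : EuclideanSpace ℝ (Fin (k + 2)), G ‖w‖ (w 0) =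
      ENNReal.ofReal (sphereArea (k + 1)) * ∫⁻ r in Set.Ioi (0 : ℝ),
        ∫⁻ θ in Set.Ioo 0 Real.pi,
          ENNReal.ofReal (r ^ (k + 1) * Real.sin θ ^ k) * G r (r * Real.cos θ) := by
  have hGc : ∀ {α : Type} [MeasurableSpace α] {u v : α → ℝ}, Measurable u → Measurable v →
      Measurable fun a ↦ G (u a) (v a) := fun hu hv ↦ hG.comp (hu.prodMk hv)
  have hw : Measurable fun w : EuclideanSpace ℝ (Fin (k + 2)) ↦ G ‖w‖ (w 0) :=
    hGc (by fun_prop) (by fun_prop)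
  -- Extended by zero to `ρ ≤ 0`, so that polar coordinates on the whole plane apply and the angles
  -- outside `(0, π)` drop out.
  set F : ℝ × ℝ → ℝ≥0∞ := fun p ↦ (Set.Ioi (0 : ℝ)).indicator
    (fun ρ ↦ ENNReal.ofReal (ρ ^ k) * G (√(p.1 ^ 2 + ρ ^ 2)) p.1) p.2 with hF
  have hFm : Measurable F := by
    have : F = ((Set.univ : Set ℝ) ×ˢ Set.Ioi (0 : ℝ)).indicator
        (fun p : ℝ × ℝ ↦ ENNReal.ofReal (p.2 ^ k) * G (√(p.1 ^ 2 + p.2 ^ 2)) p.1) := by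
      ext p
      simp [hF, Set.indicator]
    rw [this]
    refine Measurable.indicator (Measurable.mul (by fun_prop) (hGc (by fun_prop) (by fun_prop)))
      (MeasurableSet.univ.prod measurableSet_Ioi)
  calc ∫⁻ w : EuclideanSpace ℝ (Fin (k + 2)), G ‖w‖ (w 0)
      = ∫⁻ p : ℝ × EuclideanSpace ℝ (Fin (k + 1)), G (√(p.1 ^ 2 + ‖p.2‖ ^ 2)) p.1 := by
        rw [← (measurePreserving_euclideanCons (k + 1)).lintegral_comp hw]
        simp only [norm_euclideanCons, euclideanCons_zero]
    _ = ∫⁻ x : ℝ, ∫⁻ v : EuclideanSpace ℝ (Fin (k + 1)), G (√(x ^ 2 + ‖v‖ ^ 2)) x := by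
        rw [Measure.volume_eq_prod, lintegral_prod _
          (hGc (by fun_prop) (by fun_prop)).aemeasurable]
    _ = ∫⁻ x : ℝ, ENNReal.ofReal (sphereArea (k + 1)) * ∫⁻ ρ : ℝ, F (x, ρ) := by
        refine lintegral_congr fun x ↦ ?_
        rw [lintegral_comp_norm (Nat.succ_pos k) (H := fun s ↦ G (√(x ^ 2 + s ^ 2)) x)
          (hGc (by fun_prop) (by fun_prop)), ← lintegral_indicator measurableSet_Ioi]
        rfl
    _ = ENNReal.ofReal (sphereArea (k + 1)) * ∫⁻ p : ℝ × ℝ, F p := by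
        rw [lintegral_const_mul _ hFm.lintegral_prod_right', Measure.volume_eq_prod,
          lintegral_prod _ hFm.aemeasurable]
    _ = ENNReal.ofReal (sphereArea (k + 1)) * ∫⁻ p in Set.Ioi (0 : ℝ) ×ˢ Set.Ioo (0 : ℝ) Real.pi,
          ENNReal.ofReal (p.1 ^ (k + 1) * Real.sin p.2 ^ k) * G p.1 (p.1 * Real.cos p.2) := by
        congr 1
        rw [← lintegral_comp_polarCoord_symm, ← lintegral_indicator
          polarCoord.open_target.measurableSet,
          ← lintegral_indicator (measurableSet_Ioi.prod measurableSet_Ioo)]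
        refine lintegral_congr fun p ↦ ?_
        obtain ⟨r, θ⟩ := p
        by_cases hr : 0 < r
        swap
        · simp [Set.indicator, hr, polarCoord_target]
        by_cases hθ : θ ∈ Set.Ioo 0 Real.pi
        · have hs : 0 < Real.sin θ := Real.sin_pos_of_mem_Ioo hθ
          have hθ' : θ ∈ Set.Ioo (-Real.pi) Real.pi := ⟨by linarith [hθ.1, hθ.2], hθ.2⟩
          rw [Set.indicator_of_mem (by simpa [polarCoord_target] using ⟨hr, hθ'⟩),
            Set.indicator_of_mem (by simpa using ⟨hr, hθ⟩)]
          simp only [polarCoord_symm_apply, hF, smul_eq_mul]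
          rw [Set.indicator_of_mem (by exact mul_pos hr hs), ← mul_assoc,
            ← ENNReal.ofReal_mul hr.le]
          congr 2
          · ring
          · rw [show (r * Real.cos θ) ^ 2 + (r * Real.sin θ) ^ 2 =
              r ^ 2 * (Real.sin θ ^ 2 + Real.cos θ ^ 2) by ring, Real.sin_sq_add_cos_sq, mul_one,
              Real.sqrt_sq hr.le]
        · rw [Set.indicator_of_notMem (s := Set.Ioi (0 : ℝ) ×ˢ Set.Ioo (0 : ℝ) Real.pi)
            (by simpa using fun _ ↦ by simpa using hθ)]
          by_cases hθ' : θ ∈ Set.Ioo (-Real.pi) Real.pi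
          · have hs : Real.sin θ ≤ 0 := by
              refine Real.sin_nonpos_of_nonpos_of_neg_pi_le ?_ hθ'.1.le
              by_contra! h
              exact hθ ⟨h, hθ'.2⟩
            rw [Set.indicator_of_mem (by simpa [polarCoord_target] using ⟨hr, hθ'⟩)]
            simp only [polarCoord_symm_apply, hF]
            rw [Set.indicator_of_notMem (by
              simpa using mul_nonpos_of_nonneg_of_nonpos hr.le hs)]
            simp
          · rw [Set.indicator_of_notMem (by
              simpa [polarCoord_target] using fun _ ↦ by simpa using hθ')]
    _ = _ := by
        congr 1
        rw [Measure.volume_eq_prod, ← Measure.prod_restrict, lintegral_prod]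
        exact (Measurable.mul (by fun_prop) (hGc (by fun_prop) (by fun_prop))).aemeasurable

/-- The density of the norm of `a + Z` where `‖a‖ = A`. -/
noncomputable def normDensity (n : ℕ) (A r : ℝ) : ℝ :=
  Real.exp (-(r ^ 2 + A ^ 2) / 2) * besselTilde n (r * A) * r ^ (n - 1)

theorem besselTilde_nonneg {n : ℕ} (hn : 2 ≤ n) (x : ℝ) : 0 ≤ besselTilde n x := by
  have hn' : (2 : ℝ) ≤ n := by exact_mod_cast hn
  have hG : 0 ≤ Real.Gamma (((n : ℝ) - 1) / 2) :=
    Real.Gamma_nonneg_of_nonneg (by linarith)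
  unfold besselTilde
  refine mul_nonneg (by positivity) (intervalIntegral.integral_nonneg Real.pi_pos.le fun θ hθ ↦ ?_)
  have := Real.sin_nonneg_of_mem_Icc hθ
  positivity

theorem normDensity_nonneg {n : ℕ} (hn : 2 ≤ n) (A : ℝ) {r : ℝ} (hr : 0 ≤ r) :
    0 ≤ normDensity n A r := by
  have := besselTilde_nonneg hn (r * A)
  unfold normDensity; positivity

theorem measurable_normDensity (n : ℕ) (A : ℝ) : Measurable (normDensity n A) := by
  have : Continuous fun x ↦ ∫ φ in (0 : ℝ)..Real.pi,
      Real.exp (x * Real.cos φ) * Real.sin φ ^ (n - 2) :=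
    intervalIntegral.continuous_parametric_intervalIntegral_of_continuous' (by fun_prop) _ _
  unfold normDensity besselTilde
  fun_prop

/-- Identifies the prefactor of `besselTilde` in dimension `k + 2`: sphere area one dimension lower
times the Gaussian normalization. -/
theorem sphereArea_mul_two_pi_rpow (k : ℕ) :
    sphereArea (k + 1) * (2 * Real.pi) ^ (-((k + 2 : ℕ) : ℝ) / 2) =
      2 / ((2 : ℝ) ^ ((((k + 2 : ℕ) : ℝ) - 1) / 2) * Real.Gamma ((((k + 2 : ℕ) : ℝ) - 1) / 2) *
        √(2 * Real.pi)) := by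
  have h1 : (((k + 2 : ℕ) : ℝ) - 1) / 2 = ((k + 1 : ℕ) : ℝ) / 2 := by push_cast; ring
  have hG : Real.Gamma (((k + 1 : ℕ) : ℝ) / 2) ≠ 0 := (Real.Gamma_pos_of_pos (by positivity)).ne'
  rw [h1, sphereArea, show -((k + 2 : ℕ) : ℝ) / 2 = -(((k + 1 : ℕ) : ℝ) / 2 + 1 / 2) by
      push_cast; ring, Real.rpow_neg (by positivity), Real.rpow_add (by positivity),
    ← Real.sqrt_eq_rpow, Real.mul_rpow (by positivity) (by positivity)]
  field_simp

/-- After rotating `a` onto the first axis, the shifted Gaussian density depends only on `‖w‖` and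
`w 0`, and the angular integral is the one in `besselTilde`. -/
theorem lintegral_norm_add_stdGaussian {n : ℕ} (hn : 2 ≤ n) {H : ℝ → ℝ≥0∞} (hH : Measurable H)
    (a : EuclideanSpace ℝ (Fin n)) :
    ∫⁻ z, H ‖a + z‖ ∂(stdGaussian (EuclideanSpace ℝ (Fin n))) =
      ∫⁻ r in Set.Ioi (0 : ℝ), ENNReal.ofReal (normDensity n ‖a‖ r) * H r := by
  obtain ⟨k, rfl⟩ : ∃ k, n = k + 2 := ⟨n - 2, by omega⟩
  set A := ‖a‖ with hA
  have hA0 : 0 ≤ A := norm_nonneg a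
  set b : EuclideanSpace ℝ (Fin (k + 2)) := EuclideanSpace.single 0 A with hb
  have hbn : ‖b‖ = A := by simp [hb, abs_of_nonneg hA0]
  have hm : Measurable fun w : EuclideanSpace ℝ (Fin (k + 2)) ↦
      ENNReal.ofReal (gaussDensity (k + 2) (w - b)) := by fun_prop
  have hdens (w : EuclideanSpace ℝ (Fin (k + 2))) : gaussDensity (k + 2) (w - b) =
      (2 * Real.pi) ^ (-((k + 2 : ℕ) : ℝ) / 2) *
        (Real.exp (-(‖w‖ ^ 2 + A ^ 2) / 2) * Real.exp (A * w 0)) := by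
    rw [gaussDensity, norm_sub_sq_real, hbn, ← Real.exp_add]
    have : inner ℝ w b = A * w 0 := by simp [hb, EuclideanSpace.inner_single_right]
    rw [this]
    congr 2
    ring
  set G : ℝ → ℝ → ℝ≥0∞ := fun r t ↦ ENNReal.ofReal ((2 * Real.pi) ^ (-((k + 2 : ℕ) : ℝ) / 2) *
        (Real.exp (-(r ^ 2 + A ^ 2) / 2) * Real.exp (A * t))) * H r with hG
  have hGm : Measurable (Function.uncurry G) := by
    have : Function.uncurry G = fun p : ℝ × ℝ ↦ ENNReal.ofReal
      ((2 * Real.pi) ^ (-((k + 2 : ℕ) : ℝ) / 2) *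
        (Real.exp (-(p.1 ^ 2 + A ^ 2) / 2) * Real.exp (A * p.2))) * H p.1 := rfl
    rw [this]
    fun_prop
  calc ∫⁻ z, H ‖a + z‖ ∂(stdGaussian (EuclideanSpace ℝ (Fin (k + 2))))
      = ∫⁻ z, H ‖b + z‖ ∂(stdGaussian (EuclideanSpace ℝ (Fin (k + 2)))) := by
        rw [← lintegral_map (g := fun z ↦ ‖a + z‖) hH (by fun_prop),
          ← lintegral_map (g := fun z ↦ ‖b + z‖) hH (by fun_prop),
          map_norm_add_stdGaussian_congr hbn.symm]
    _ = ∫⁻ w : EuclideanSpace ℝ (Fin (k + 2)), G ‖w‖ (w 0) := by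
        rw [← lintegral_map (f := fun w ↦ H ‖w‖) (g := fun z ↦ b + z) (by fun_prop) (by fun_prop),
          map_add_stdGaussian, lintegral_withDensity_eq_lintegral_mul _ hm (by fun_prop)]
        refine lintegral_congr fun w ↦ ?_
        simp only [Pi.mul_apply, hdens, hG]
    _ = ENNReal.ofReal (sphereArea (k + 1)) * ∫⁻ r in Set.Ioi (0 : ℝ),
        ∫⁻ θ in Set.Ioo 0 Real.pi,
          ENNReal.ofReal (r ^ (k + 1) * Real.sin θ ^ k) * G r (r * Real.cos θ) :=
        lintegral_norm_coord hGm
    _ = _ := by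
        have hm2 : Measurable fun r ↦ ∫⁻ θ in Set.Ioo 0 Real.pi,
            ENNReal.ofReal (r ^ (k + 1) * Real.sin θ ^ k) * G r (r * Real.cos θ) := by
          refine Measurable.lintegral_prod_right' (f := fun p : ℝ × ℝ ↦
            ENNReal.ofReal (p.1 ^ (k + 1) * Real.sin p.2 ^ k) * G p.1 (p.1 * Real.cos p.2)) ?_
          exact Measurable.mul (by fun_prop) (hGm.comp (by fun_prop :
            Measurable fun p : ℝ × ℝ ↦ (p.1, p.1 * Real.cos p.2)))
        rw [← lintegral_const_mul _ hm2]
        refine setLIntegral_congr_fun measurableSet_Ioi fun r hr ↦ ?_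
        have hr0 : 0 < r := hr
        set c := (2 * Real.pi) ^ (-((k + 2 : ℕ) : ℝ) / 2) with hc
        have hc0 : 0 < c := by positivity
        have hin : ∀ θ ∈ Set.Ioo 0 Real.pi,
            ENNReal.ofReal (r ^ (k + 1) * Real.sin θ ^ k) * G r (r * Real.cos θ) =
            ENNReal.ofReal (c * Real.exp (-(r ^ 2 + A ^ 2) / 2) * r ^ (k + 1)) * H r *
              ENNReal.ofReal (Real.exp (r * A * Real.cos θ) * Real.sin θ ^ k) := by
          intro θ hθ
          have hs : 0 < Real.sin θ := Real.sin_pos_of_mem_Ioo hθ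
          simp only [hG]
          rw [← mul_assoc, ← ENNReal.ofReal_mul (by positivity),
            mul_right_comm (ENNReal.ofReal (c * _ * _)), ← ENNReal.ofReal_mul (by positivity)]
          congr 2
          rw [show A * (r * Real.cos θ) = r * A * Real.cos θ by ring]
          ring
        have hI : ∫⁻ θ in Set.Ioo 0 Real.pi,
            ENNReal.ofReal (Real.exp (r * A * Real.cos θ) * Real.sin θ ^ k) =
            ENNReal.ofReal (∫ θ in (0 : ℝ)..Real.pi,
              Real.exp (r * A * Real.cos θ) * Real.sin θ ^ k) := by
          rw [intervalIntegral.integral_of_le Real.pi_pos.le, integral_Ioc_eq_integral_Ioo,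
            ofReal_integral_eq_lintegral_ofReal]
          · exact (Continuous.integrableOn_Icc (by fun_prop)).mono_set Set.Ioo_subset_Icc_self
          · filter_upwards [ae_restrict_mem measurableSet_Ioo] with θ hθ
            have hs : 0 < Real.sin θ := Real.sin_pos_of_mem_Ioo hθ
            positivity
        have hInn : 0 ≤ ∫ θ in (0 : ℝ)..Real.pi,
            Real.exp (r * A * Real.cos θ) * Real.sin θ ^ k := by
          refine intervalIntegral.integral_nonneg Real.pi_pos.le fun θ hθ ↦ ?_
          have := Real.sin_nonneg_of_mem_Icc hθ
          positivity
        have hS := sphereArea_nonneg (k + 1)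
        rw [setLIntegral_congr_fun measurableSet_Ioo hin,
          lintegral_const_mul _ (by fun_prop), hI, mul_right_comm, ← mul_assoc, ← mul_assoc,
          ← ENNReal.ofReal_mul hS, ← ENNReal.ofReal_mul (by positivity)]
        congr 2
        rw [normDensity, besselTilde, ← sphereArea_mul_two_pi_rpow]
        simp only [Nat.add_sub_cancel, show k + 2 - 1 = k + 1 from rfl]
        ring

theorem map_norm_add_stdGaussian {n : ℕ} (hn : 2 ≤ n) (a : EuclideanSpace ℝ (Fin n)) :
    (stdGaussian (EuclideanSpace ℝ (Fin n))).map (fun z ↦ ‖a + z‖) =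
      (volume.restrict (Set.Ioi 0)).withDensity
        fun r ↦ ENNReal.ofReal (normDensity n ‖a‖ r) := by
  refine Measure.ext_of_lintegral _ fun H hH ↦ ?_
  rw [lintegral_map hH (by fun_prop), lintegral_norm_add_stdGaussian hn hH,
    lintegral_withDensity_eq_lintegral_mul _ (measurable_normDensity n _).ennreal_ofReal hH]
  rfl

theorem integral_norm_add_stdGaussian {n : ℕ} (hn : 2 ≤ n) {g : ℝ → ℝ} (hg : Measurable g)
    (a : EuclideanSpace ℝ (Fin n)) :
    ∫ z, g ‖a + z‖ ∂(stdGaussian (EuclideanSpace ℝ (Fin n))) =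
      ∫ r in Set.Ioi (0 : ℝ), g r * normDensity n ‖a‖ r := by
  rw [← integral_map (φ := fun z ↦ ‖a + z‖) (f := g) (by fun_prop) hg.aestronglyMeasurable,
    map_norm_add_stdGaussian hn, integral_withDensity_eq_integral_toReal_smul
      (measurable_normDensity n _).ennreal_ofReal (by simp)]
  refine setIntegral_congr_fun measurableSet_Ioi fun r hr ↦ ?_
  have hr0 : 0 < r := hr
  simp only [ENNReal.toReal_ofReal (normDensity_nonneg hn _ hr0.le), smul_eq_mul, mul_comm]

end Polar

/-! ### The constant `kConst` as a polynomial in the amplitude -/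

section GaussianMoments

/-- The moments of the half-line Gaussian weight. -/
noncomputable def halfMoment (j : ℕ) : ℝ :=
  ∫ s in Set.Ioi (0 : ℝ), Real.exp (-s ^ 2 / 2) * s ^ j

theorem integrableOn_halfMoment (j : ℕ) :
    IntegrableOn (fun s : ℝ ↦ Real.exp (-s ^ 2 / 2) * s ^ j) (Set.Ioi 0) := by
  have h := integrableOn_rpow_mul_exp_neg_mul_sq (b := 1 / 2) (by norm_num) (s := j)
    (by have : (0 : ℝ) ≤ j := by positivity
        linarith)
  refine h.congr_fun (fun s _ ↦ ?_) measurableSet_Ioi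
  simp only [Real.rpow_natCast]
  rw [mul_comm]
  congr 2
  ring

theorem halfMoment_pos (j : ℕ) : 0 < halfMoment j := by
  refine (setIntegral_pos_iff_support_of_nonneg_ae ?_ (integrableOn_halfMoment j)).2 ?_
  · filter_upwards [ae_restrict_mem measurableSet_Ioi] with s hs
    have : 0 < s := hs
    positivity
  · have : (Function.support fun s : ℝ ↦ Real.exp (-s ^ 2 / 2) * s ^ j) ∩ Set.Ioi 0 =
        Set.Ioi 0 := by
      refine Set.inter_eq_right.2 fun s hs ↦ ?_
      have : 0 < s := hs
      rw [Function.mem_support]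
      positivity
    rw [this]
    simp

/-- Shows that the prefactor of `kConst` is the inverse of this moment, so the constant term of the
polynomial is `1`. -/
theorem halfMoment_sub_one {n : ℕ} (hn : 0 < n) :
    halfMoment (n - 1) = (2 : ℝ) ^ ((n : ℝ) / 2) * Real.Gamma ((n : ℝ) / 2) / 2 := by
  have h := integral_rpow_mul_exp_neg_mul_rpow (p := 2) (q := (n : ℝ) - 1) (b := 1 / 2)
    (by norm_num) (by have : (0 : ℝ) < n := by positivity
                      linarith) (by norm_num)
  rw [sub_add_cancel] at h
  have e : halfMoment (n - 1) =
      ∫ x in Set.Ioi (0 : ℝ), x ^ ((n : ℝ) - 1) * Real.exp (-(1 / 2) * x ^ (2 : ℝ)) := by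
    refine setIntegral_congr_fun measurableSet_Ioi fun s _ ↦ ?_
    rw [show (n : ℝ) - 1 = ((n - 1 : ℕ) : ℝ) by push_cast [Nat.one_le_iff_ne_zero.2 hn.ne']; ring]
    simp only [Real.rpow_natCast, Real.rpow_two]
    rw [mul_comm]
    congr 2
    ring
  rw [e, h, one_div, Real.inv_rpow (by norm_num), neg_div, Real.rpow_neg (by norm_num), inv_inv]
  ring

theorem exp_mul_add_pow (N : ℕ) (A s : ℝ) :
    Real.exp (-s ^ 2 / 2) * (s + A) ^ N =
      ∑ j ∈ Finset.range (N + 1),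
        A ^ (N - j) * N.choose j * (Real.exp (-s ^ 2 / 2) * s ^ j) := by
  rw [add_pow, Finset.mul_sum]
  exact Finset.sum_congr rfl fun j _ ↦ by ring

theorem integrableOn_exp_mul_add_pow (N : ℕ) (A : ℝ) :
    IntegrableOn (fun s : ℝ ↦ Real.exp (-s ^ 2 / 2) * (s + A) ^ N) (Set.Ioi 0) := by
  simp_rw [exp_mul_add_pow]
  exact integrable_finsetSum _ fun j _ ↦ (integrableOn_halfMoment j).const_mul _

theorem integral_exp_mul_add_pow (N : ℕ) (A : ℝ) :
    ∫ s in Set.Ioi (0 : ℝ), Real.exp (-s ^ 2 / 2) * (s + A) ^ N =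
      ∑ j ∈ Finset.range (N + 1), A ^ (N - j) * N.choose j * halfMoment j := by
  simp_rw [exp_mul_add_pow]
  rw [integral_finsetSum _ fun j _ ↦ (integrableOn_halfMoment j).const_mul _]
  simp_rw [integral_const_mul, halfMoment]

theorem integrableOn_exp_sub_mul_pow (N : ℕ) (A : ℝ) :
    IntegrableOn (fun r : ℝ ↦ Real.exp (-(r - A) ^ 2 / 2) * r ^ N) (Set.Ioi A) := by
  have h := (measurePreserving_add_right (volume : Measure ℝ) A).integrableOn_comp_preimage
    (measurableEmbedding_addRight A) (s := Set.Ioi A)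
    (f := fun r : ℝ ↦ Real.exp (-(r - A) ^ 2 / 2) * r ^ N)
  refine h.1 ?_
  simpa [Function.comp_def] using integrableOn_exp_mul_add_pow N A

/-- Substitute `r = s + A` and expand `(s + A) ^ (n - 1)`. Continuity and both growth bounds are
read off from this polynomial with positive coefficients. -/
theorem kConst_eq_sum {n : ℕ} (hn : 0 < n) (A : ℝ) :
    kConst n A = (halfMoment (n - 1))⁻¹ *
      ∑ j ∈ Finset.range (n - 1 + 1), A ^ (n - 1 - j) * (n - 1).choose j * halfMoment j := by
  have h := (measurePreserving_add_right (volume : Measure ℝ) A).setIntegral_preimage_emb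
    (measurableEmbedding_addRight A)
    (fun r : ℝ ↦ Real.exp (-(r - A) ^ 2 / 2) * r ^ (n - 1)) (Set.Ioi A)
  simp only [add_sub_cancel_right, Set.preimage_add_const_Ioi, sub_self] at h
  rw [kConst, ← h, integral_exp_mul_add_pow, halfMoment_sub_one hn, inv_div]

theorem continuous_kConst {n : ℕ} (hn : 0 < n) : Continuous (kConst n) := by
  have : kConst n = fun A ↦ (halfMoment (n - 1))⁻¹ *
      ∑ j ∈ Finset.range (n - 1 + 1), A ^ (n - 1 - j) * (n - 1).choose j * halfMoment j :=
    funext (kConst_eq_sum hn)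
  rw [this]
  fun_prop

theorem exists_pos_add_mul_le_kConst {n : ℕ} (hn : 2 ≤ n) :
    ∃ c > 0, ∀ A, 0 ≤ A → 1 + c * A ≤ kConst n A := by
  obtain ⟨k, rfl⟩ : ∃ k, n = k + 2 := ⟨n - 2, by omega⟩
  have h0 := halfMoment_pos k
  have h1 := halfMoment_pos (k + 1)
  -- The coefficient of `A` in the polynomial; the higher powers are dropped.
  refine ⟨(halfMoment (k + 1))⁻¹ * ((k + 1) * halfMoment k), by positivity, fun A hA ↦ ?_⟩
  rw [kConst_eq_sum (by omega), show k + 2 - 1 = k + 1 from rfl, Finset.sum_range_succ,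
    Finset.sum_range_succ]
  have hs : 0 ≤ ∑ j ∈ Finset.range k,
      A ^ (k + 1 - j) * ((k + 1).choose j : ℝ) * halfMoment j :=
    Finset.sum_nonneg fun j _ ↦ by have := halfMoment_pos j; positivity
  have e1 : k + 1 - k = 1 := by omega
  simp only [e1, Nat.sub_self, pow_zero, pow_one, Nat.choose_self, Nat.cast_one, mul_one, one_mul,
    Nat.choose_succ_self_right]
  have : (halfMoment (k + 1))⁻¹ * halfMoment (k + 1) = 1 := inv_mul_cancel₀ h1.ne'
  have h2 : 0 ≤ (halfMoment (k + 1))⁻¹ * ∑ j ∈ Finset.range k,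
      A ^ (k + 1 - j) * ((k + 1).choose j : ℝ) * halfMoment j := by positivity
  push_cast
  rw [mul_add, mul_add, this]
  linarith

theorem kConst_pos {n : ℕ} (hn : 2 ≤ n) {A : ℝ} (hA : 0 ≤ A) : 0 < kConst n A := by
  obtain ⟨c, hc, h⟩ := exists_pos_add_mul_le_kConst hn
  have := h A hA
  have : 0 ≤ c * A := by positivity
  linarith

theorem exists_kConst_le {n : ℕ} (hn : 0 < n) :
    ∃ D, ∀ A, 1 ≤ A → kConst n A ≤ D * A ^ (n - 1) := by
  refine ⟨(halfMoment (n - 1))⁻¹ *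
    ∑ j ∈ Finset.range (n - 1 + 1), (n - 1).choose j * halfMoment j, fun A hA ↦ ?_⟩
  have h1 := halfMoment_pos (n - 1)
  rw [kConst_eq_sum hn, mul_assoc, Finset.sum_mul]
  refine mul_le_mul_of_nonneg_left (Finset.sum_le_sum fun j _ ↦ ?_) (by positivity)
  have h2 := halfMoment_pos j
  have : A ^ (n - 1 - j) ≤ A ^ (n - 1) := pow_le_pow_right₀ hA (by omega)
  calc _ = ((n - 1).choose j * halfMoment j) * A ^ (n - 1 - j) := by ring
    _ ≤ _ := by gcongr

/-- This is the mass by which the outer part of the reference law is normalized. -/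
theorem lintegral_exp_norm_sub {n : ℕ} (hn : 0 < n) {A : ℝ} (hA : 0 ≤ A) :
    ∫⁻ y : EuclideanSpace ℝ (Fin n), (Set.Ioi A).indicator
        (fun r ↦ ENNReal.ofReal (Real.exp (-(r - A) ^ 2 / 2))) ‖y‖ =
      ENNReal.ofReal ((2 * Real.pi) ^ ((n : ℝ) / 2) * kConst n A) := by
  rw [lintegral_comp_norm hn (Measurable.indicator (by fun_prop) measurableSet_Ioi)]
  have hG : 0 < Real.Gamma ((n : ℝ) / 2) := Real.Gamma_pos_of_pos (by positivity)
  have e1 : (2 * Real.pi) ^ ((n : ℝ) / 2) * kConst n A =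
      sphereArea n * ∫ r in Set.Ioi A, Real.exp (-(r - A) ^ 2 / 2) * r ^ (n - 1) := by
    rw [kConst, sphereArea, Real.mul_rpow (by positivity) (by positivity)]
    field_simp
  rw [e1, ENNReal.ofReal_mul (sphereArea_nonneg n), ofReal_integral_eq_lintegral_ofReal
    (integrableOn_exp_sub_mul_pow _ _)]
  · congr 1
    rw [← lintegral_indicator measurableSet_Ioi, ← lintegral_indicator measurableSet_Ioi]
    refine lintegral_congr fun r ↦ ?_
    by_cases hr : A < r
    · have hr0 : 0 < r := hA.trans_lt hr
      rw [Set.indicator_of_mem (by exact hr0), Set.indicator_of_mem (by exact hr),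
        Set.indicator_of_mem (by exact hr), ← ENNReal.ofReal_mul (by positivity), mul_comm]
    · simp [Set.indicator, hr]
  · filter_upwards [ae_restrict_mem measurableSet_Ioi] with r hr
    have : 0 < r := hA.trans_lt hr
    positivity

end GaussianMoments

/-! ### The reference law and the bound at a fixed amplitude -/

section RefinedBound

variable {n : ℕ}

theorem exists_euclidean_norm_eq (hn : 2 ≤ n) {A : ℝ} (hA : 0 ≤ A) :
    ∃ a : EuclideanSpace ℝ (Fin n), ‖a‖ = A := by
  have : Nonempty (Fin n) := ⟨⟨0, by omega⟩⟩
  exact exists_norm_eq _ hA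

theorem integral_indicator_norm_add (hn : 2 ≤ n) {R : ℝ} (hR : 0 ≤ R) {g : ℝ → ℝ}
    (hg : Measurable g) (a : EuclideanSpace ℝ (Fin n)) :
    ∫ z, (Set.Ioi R).indicator g ‖a + z‖ ∂(stdGaussian (EuclideanSpace ℝ (Fin n))) =
      ∫ r in Set.Ioi R, g r * normDensity n ‖a‖ r := by
  rw [integral_norm_add_stdGaussian hn (hg.indicator measurableSet_Ioi)]
  simp_rw [← Set.indicator_mul_left]
  rw [setIntegral_indicator measurableSet_Ioi, Set.Ioi_inter_Ioi, sup_eq_right.2 hR]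

theorem marcumQ_eq_integral (hn : 2 ≤ n) {R : ℝ} (hR : 0 ≤ R) (a : EuclideanSpace ℝ (Fin n)) :
    marcumQ n ‖a‖ R = ∫ z, (Set.Ioi R).indicator (fun _ ↦ (1 : ℝ)) ‖a + z‖
      ∂(stdGaussian (EuclideanSpace ℝ (Fin n))) := by
  rw [integral_indicator_norm_add hn hR measurable_const]
  simp only [one_mul]
  rfl

theorem gTilde_eq_integral (hn : 2 ≤ n) {R : ℝ} (hR : 0 ≤ R) {a : EuclideanSpace ℝ (Fin n)}
    (ha : ‖a‖ = R) :
    gTilde n R R = ∫ z, (Set.Ioi R).indicator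
        (fun r ↦ (n : ℝ) / 2 - (r - R) ^ 2 / 2) ‖a + z‖
      ∂(stdGaussian (EuclideanSpace ℝ (Fin n))) := by
  rw [integral_indicator_norm_add hn hR (by fun_prop), ha]
  rfl

theorem one_sub_marcumQ_eq (hn : 2 ≤ n) {R : ℝ} (hR : 0 ≤ R) (a : EuclideanSpace ℝ (Fin n)) :
    1 - marcumQ n ‖a‖ R = (stdGaussian (EuclideanSpace ℝ (Fin n))).real {z | ‖a + z‖ ≤ R} := by
  have hs : MeasurableSet {z : EuclideanSpace ℝ (Fin n) | ‖a + z‖ ≤ R} :=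
    measurableSet_le (by fun_prop) measurable_const
  rw [marcumQ_eq_integral hn hR]
  have : (fun z : EuclideanSpace ℝ (Fin n) ↦ (Set.Ioi R).indicator (fun _ ↦ (1 : ℝ)) ‖a + z‖) =
      {z | ‖a + z‖ ≤ R}ᶜ.indicator 1 := by
    ext z
    simp [Set.indicator]
  rw [this, integral_indicator_one hs.compl, probReal_compl_eq_one_sub hs, sub_sub_cancel]

/-- With `‖a‖ = A`, the event `‖a + z‖ ≤ A` and its mirror image under `z ↦ -z` have equal
probability, and by the parallelogram law they meet only in the null set `{0}`. -/
theorem one_sub_marcumQ_le_half (hn : 2 ≤ n) {A : ℝ} (hA : 0 ≤ A) :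
    1 - marcumQ n A A ≤ 1 / 2 := by
  obtain ⟨a, ha⟩ := exists_euclidean_norm_eq hn hA
  have : Nonempty (Fin n) := ⟨⟨0, by omega⟩⟩
  set γ := stdGaussian (EuclideanSpace ℝ (Fin n)) with hγ
  set s : Set (EuclideanSpace ℝ (Fin n)) := {z | ‖a + z‖ ≤ A} with hs
  have hsm : MeasurableSet s := measurableSet_le (by fun_prop) measurable_const
  have hneg : γ.real (Neg.neg ⁻¹' s) = γ.real s := by
    have := stdGaussian_map (LinearIsometryEquiv.neg ℝ (E := EuclideanSpace ℝ (Fin n)))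
    conv_rhs => rw [hγ, ← this]
    rw [map_measureReal_apply (LinearIsometryEquiv.continuous _).measurable hsm]
    rfl
  have hinter : s ∩ Neg.neg ⁻¹' s ⊆ {0} := by
    rintro z ⟨h1, h2⟩
    have h1' : ‖a + z‖ ^ 2 ≤ A ^ 2 := by
      have : ‖a + z‖ ≤ A := h1
      gcongr
    have h2' : ‖a - z‖ ^ 2 ≤ A ^ 2 := by
      have : ‖a + -z‖ ≤ A := h2
      rw [sub_eq_add_neg]
      gcongr
    rw [norm_add_sq_real, ha] at h1'
    rw [norm_sub_sq_real, ha] at h2'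
    have : ‖z‖ ^ 2 ≤ 0 := by linarith
    simpa using this
  have hnull : γ.real (s ∩ Neg.neg ⁻¹' s) = 0 := by
    have h0 : γ {0} = 0 := by
      rw [hγ, stdGaussian_eq_withDensity]
      exact withDensity_absolutelyContinuous _ _ (measure_singleton _)
    rw [measureReal_def, measure_mono_null hinter h0, ENNReal.toReal_zero]
  have hun := measureReal_union_add_inter (μ := γ) (s := s) (hsm.preimage measurable_neg)
  have h1 : γ.real (s ∪ Neg.neg ⁻¹' s) ≤ 1 := measureReal_le_one
  have h2 := one_sub_marcumQ_eq hn hA a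
  rw [ha] at h2
  rw [h2]
  linarith

theorem ballVol_eq {A : ℝ} (hA : 0 ≤ A) : ballVol n A = A ^ n * ballVol n 1 := by
  rw [ballVol, ballVol, Measure.addHaar_real_closedBall' _ _ hA]
  simp

theorem ballVol_pos {A : ℝ} (hA : 0 < A) : 0 < ballVol n A :=
  ENNReal.toReal_pos (Metric.measure_closedBall_pos _ _ hA).ne' measure_closedBall_lt_top.ne

/-- The negative log-density that is the constant `p` on the ball of radius `A` and
`q + (r - A)² / 2` outside. -/
noncomputable def energy (A p q r : ℝ) : ℝ :=
  p + (Set.Ioi A).indicator (fun r ↦ q - p + (r - A) ^ 2 / 2) r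

theorem energy_of_le {A p q r : ℝ} (h : r ≤ A) : energy A p q r = p := by
  simp [energy, h]

theorem energy_of_lt {A p q r : ℝ} (h : A < r) : energy A p q r = q + (r - A) ^ 2 / 2 := by
  rw [energy, Set.indicator_of_mem (by exact h)]
  ring

/-- The hypothesis `p ≤ q` is needed only for the jump at `A`. -/
theorem monotone_energy {A p q : ℝ} (h : p ≤ q) : Monotone (energy A p q) := by
  intro r s hrs
  rcases le_or_gt s A with hs | hs
  · rw [energy_of_le hs, energy_of_le (hrs.trans hs)]
  · rcases le_or_gt r A with hr | hr
    · rw [energy_of_le hr, energy_of_lt hs]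
      linarith [sq_nonneg (s - A)]
    · rw [energy_of_lt hr, energy_of_lt hs]
      nlinarith

theorem abs_energy_le (A p q r : ℝ) :
    |energy A p q r| ≤ (|p| + |q| + 1 + A ^ 2) * (1 + r ^ 2) := by
  have h1 : |energy A p q r| ≤ |p| + |q| + (r - A) ^ 2 / 2 := by
    rcases le_or_gt r A with hr | hr
    · rw [energy_of_le hr]
      linarith [abs_nonneg q, sq_nonneg (r - A)]
    · rw [energy_of_lt hr]
      refine (abs_add_le _ _).trans ?_
      rw [abs_of_nonneg (by positivity : 0 ≤ (r - A) ^ 2 / 2)]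
      linarith [abs_nonneg p]
  have h2 : 0 ≤ (|p| + |q|) * r ^ 2 := by positivity
  nlinarith [sq_nonneg (r + A), sq_nonneg (A * r), sq_nonneg r, sq_nonneg A]

theorem isProbabilityMeasure_radialLaw_energy (hn : 2 ≤ n) {A b : ℝ} (hA : 0 < A) (hb0 : 0 < b)
    (hb1 : b < 1) :
    IsProbabilityMeasure (radialLaw n (energy A (-Real.log (b / ballVol n A))
      (-Real.log ((1 - b) / ((2 * Real.pi) ^ ((n : ℝ) / 2) * kConst n A))))) := by
  have hV := ballVol_pos (n := n) hA
  have hK : 0 < (2 * Real.pi) ^ ((n : ℝ) / 2) * kConst n A :=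
    mul_pos (by positivity) (kConst_pos hn hA.le)
  have hb : 0 < 1 - b := by linarith
  set K := (2 * Real.pi) ^ ((n : ℝ) / 2) * kConst n A with hKdef
  refine ⟨?_⟩
  rw [radialLaw, withDensity_apply _ MeasurableSet.univ, Measure.restrict_univ]
  -- The density splits into a ball part of total mass `b` and an outer part of total mass `1 - b`.
  have hsplit (y : EuclideanSpace ℝ (Fin n)) :
      ENNReal.ofReal (Real.exp (-energy A (-Real.log (b / ballVol n A))
        (-Real.log ((1 - b) / K)) ‖y‖)) =
      (Metric.closedBall 0 A).indicator (fun _ ↦ ENNReal.ofReal (b / ballVol n A)) y +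
      ENNReal.ofReal ((1 - b) / K) * (Set.Ioi A).indicator
        (fun r ↦ ENNReal.ofReal (Real.exp (-(r - A) ^ 2 / 2))) ‖y‖ := by
    rcases le_or_gt ‖y‖ A with hy | hy
    · rw [energy_of_le hy, neg_neg, Real.exp_log (by positivity),
        Set.indicator_of_mem (by simpa using hy), Set.indicator_of_notMem (by simpa using hy)]
      simp
    · rw [energy_of_lt hy, Set.indicator_of_notMem (by simpa using hy),
        Set.indicator_of_mem (by exact hy), zero_add, ← ENNReal.ofReal_mul (by positivity),
        neg_add, neg_neg, Real.exp_add, Real.exp_log (by positivity), neg_div]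
  have hm : Measurable fun y : EuclideanSpace ℝ (Fin n) ↦ (Set.Ioi A).indicator
      (fun r ↦ ENNReal.ofReal (Real.exp (-(r - A) ^ 2 / 2))) ‖y‖ :=
    (Measurable.indicator (by fun_prop) measurableSet_Ioi).comp measurable_norm
  simp_rw [hsplit]
  rw [lintegral_add_left (measurable_const.indicator measurableSet_closedBall),
    lintegral_indicator measurableSet_closedBall, setLIntegral_const,
    lintegral_const_mul _ hm, lintegral_exp_norm_sub (by omega) hA.le, ← hKdef,
    ← ENNReal.ofReal_mul (by positivity), div_mul_cancel₀ _ hK.ne',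
    ← ofReal_measureReal measure_closedBall_lt_top.ne]
  change ENNReal.ofReal (b / ballVol n A) * ENNReal.ofReal (ballVol n A) + _ = 1
  rw [← ENNReal.ofReal_mul (by positivity), div_mul_cancel₀ _ hV.ne',
    ← ENNReal.ofReal_add hb0.le hb.le]
  simp

/-- The integrand of `gTilde` carries an `n / 2` that the energy lacks; the extra `n / 2` in front
of `marcumQ` compensates for it. -/
theorem integral_energy (hn : 2 ≤ n) {A : ℝ} (hA : 0 ≤ A) (p q : ℝ)
    {a : EuclideanSpace ℝ (Fin n)} (ha : ‖a‖ = A) :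
    ∫ z, energy A p q ‖a + z‖ ∂(stdGaussian (EuclideanSpace ℝ (Fin n))) =
      p + (q - p + n / 2) * marcumQ n A A - gTilde n A A := by
  set γ := stdGaussian (EuclideanSpace ℝ (Fin n)) with hγ
  set u : ℝ → ℝ := (Set.Ioi A).indicator fun _ ↦ (1 : ℝ) with hu
  set v : ℝ → ℝ := (Set.Ioi A).indicator fun r ↦ (n : ℝ) / 2 - (r - A) ^ 2 / 2 with hv
  have hum : Measurable u := measurable_const.indicator measurableSet_Ioi
  have hvm : Measurable v := Measurable.indicator (by fun_prop) measurableSet_Ioi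
  have hui : Integrable (fun z ↦ u ‖a + z‖) γ := by
    refine integrable_comp_norm_add hum (C := 1) (fun r ↦ ?_) a
    have : |u r| ≤ 1 := by
      by_cases hr : A < r <;> simp [hu, hr]
    nlinarith [sq_nonneg r]
  have hvi : Integrable (fun z ↦ v ‖a + z‖) γ := by
    refine integrable_comp_norm_add hvm (C := n / 2 + 1 + A ^ 2) (fun r ↦ ?_) a
    have hn0 : (0 : ℝ) ≤ n / 2 := by positivity
    have : |v r| ≤ n / 2 + (r - A) ^ 2 / 2 := by
      by_cases hr : A < r
      · simp only [hv, Set.indicator, Set.mem_Ioi, hr, if_true]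
        refine (abs_sub _ _).trans ?_
        rw [abs_of_nonneg hn0, abs_of_nonneg (by positivity : 0 ≤ (r - A) ^ 2 / 2)]
      · simp only [hv, Set.indicator, Set.mem_Ioi, hr, if_false, abs_zero]
        positivity
    have h2 : 0 ≤ (n / 2 : ℝ) * r ^ 2 := by positivity
    nlinarith [sq_nonneg (r + A), sq_nonneg (A * r), sq_nonneg r, sq_nonneg A]
  have hen (r : ℝ) : energy A p q r = p + (q - p + n / 2) * u r - v r := by
    rcases le_or_gt r A with hr | hr
    · rw [energy_of_le hr]
      simp [hu, hv, hr]
    · rw [energy_of_lt hr, hu, hv, Set.indicator_of_mem (by exact hr),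
        Set.indicator_of_mem (by exact hr)]
      ring
  have hQ : marcumQ n A A = ∫ z, u ‖a + z‖ ∂γ := by
    rw [← marcumQ_eq_integral hn hA, ha]
  have hT : gTilde n A A = ∫ z, v ‖a + z‖ ∂γ := gTilde_eq_integral hn hA ha
  rw [hT, hQ]
  simp_rw [hen]
  have h1 : Integrable (fun z ↦ p + (q - p + n / 2) * u ‖a + z‖) γ :=
    (integrable_const _).add (hui.const_mul _)
  rw [integral_sub h1 hvi, integral_add (integrable_const _) (hui.const_mul _),
    integral_const_mul]
  simp

/-- The capacity bound in terms of the amplitude. -/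
theorem capacity_le_of_betaLower_le (hn : 2 ≤ n) {A : ℝ} (hA : 0 < A)
    (h : betaLower n A ≤ 1 - marcumQ n A A) :
    ((capacity n A : ℝ≥0∞) : EReal) ≤
      (((1 - (1 - marcumQ n A A)) * Real.log (kConst n A) + (1 - marcumQ n A A) *
        Real.log (ballVol n A / (2 * Real.pi * Real.exp 1) ^ ((n : ℝ) / 2))
        + Real.binEntropy (1 - marcumQ n A A) - gTilde n A A : ℝ) : EReal) := by
  have hV := ballVol_pos (n := n) hA
  have hk := kConst_pos hn hA.le
  have hpi : (0 : ℝ) < (2 * Real.pi) ^ ((n : ℝ) / 2) := by positivity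
  have hK : 0 < (2 * Real.pi) ^ ((n : ℝ) / 2) * kConst n A := mul_pos hpi hk
  have hhalf := one_sub_marcumQ_le_half hn hA.le
  -- The reference law gives the ball the probability that the output of a boundary input lands
  -- there. This turns the cross-entropy of the two masses into `binEntropy b`, its least value.
  set b := 1 - marcumQ n A A with hb
  have hb0 : 0 < b := lt_of_lt_of_le (by unfold betaLower; positivity) h
  have hb1 : 0 < 1 - b := by linarith
  have := isProbabilityMeasure_radialLaw_energy hn hA hb0 (by linarith)
  have hmono : Monotone (energy A (-Real.log (b / ballVol n A))
      (-Real.log ((1 - b) / ((2 * Real.pi) ^ ((n : ℝ) / 2) * kConst n A)))) := by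
    -- No upward jump of the density means `(1 - b) / K ≤ b / Vol` with `K = (2π)^{n/2} kₙ(A)`,
    -- which is (*) rearranged.
    refine monotone_energy (neg_le_neg (Real.log_le_log (by positivity) ?_))
    rw [div_le_div_iff₀ hK hV]
    rw [betaLower, div_le_iff₀ (by positivity)] at h
    linarith
  refine capacity_le hmono.measurable hA.le (abs_energy_le _ _ _) fun x hx ↦ ?_
  obtain ⟨a, ha⟩ := exists_euclidean_norm_eq hn hA.le
  refine (sub_le_sub_right (integral_norm_add_le hmono (abs_energy_le _ _ _)
    (hx.trans ha.ge)) _).trans (le_of_eq ?_)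
  rw [integral_energy hn hA.le _ _ ha, show marcumQ n A A = 1 - b by rw [hb]; ring,
    Real.binEntropy, Real.log_inv, Real.log_inv, Real.log_div hb0.ne' hV.ne',
    Real.log_div hb1.ne' hK.ne', Real.log_mul hpi.ne' hk.ne',
    Real.log_div hV.ne' (by positivity), Real.log_rpow (by positivity),
    Real.log_rpow (by positivity), Real.log_mul (x := 2 * Real.pi) (by positivity) (by positivity),
    Real.log_exp]
  ring

end RefinedBound

/-! ### Existence of the least crossing -/

section Threshold

variable {n : ℕ}

/-- The substitution `w = A • u` fixes the domain of integration, so continuity in `A` and pointwise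
bounds pass through the integral. -/
theorem one_sub_marcumQ_smul (hn : 2 ≤ n) {e : EuclideanSpace ℝ (Fin n)} (he : ‖e‖ = 1) {A : ℝ}
    (hA : 0 < A) :
    1 - marcumQ n A A =
      A ^ n * ∫ u in Metric.closedBall (0 : EuclideanSpace ℝ (Fin n)) 1,
        gaussDensity n (A • (u - e)) := by
  have hs : MeasurableSet (Metric.closedBall (0 : EuclideanSpace ℝ (Fin n)) A) :=
    measurableSet_closedBall
  have hAe : ‖A • e‖ = A := by rw [norm_smul, he, mul_one, Real.norm_of_nonneg hA.le]
  have h1 := one_sub_marcumQ_eq hn hA.le (A • e)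
  rw [hAe] at h1
  have h2 : (stdGaussian (EuclideanSpace ℝ (Fin n))).real {z | ‖A • e + z‖ ≤ A} =
      ∫ z, (Metric.closedBall (0 : EuclideanSpace ℝ (Fin n)) A).indicator (fun _ ↦ (1 : ℝ))
        (A • e + z) ∂(stdGaussian (EuclideanSpace ℝ (Fin n))) := by
    rw [← integral_indicator_one (measurableSet_le (by fun_prop) measurable_const)]
    congr 1
    ext z
    simp [Set.indicator]
  rw [h1, h2, integral_add_stdGaussian (measurable_const.indicator hs)]
  have h3 := Measure.integral_comp_smul (volume : Measure (EuclideanSpace ℝ (Fin n)))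
    (fun w ↦ gaussDensity n (w - A • e) *
      (Metric.closedBall (0 : EuclideanSpace ℝ (Fin n)) A).indicator (fun _ ↦ (1 : ℝ)) w) A
  rw [← integral_indicator measurableSet_closedBall]
  have h4 : ∀ u : EuclideanSpace ℝ (Fin n), gaussDensity n (A • u - A • e) *
      (Metric.closedBall (0 : EuclideanSpace ℝ (Fin n)) A).indicator (fun _ ↦ (1 : ℝ)) (A • u) =
      (Metric.closedBall (0 : EuclideanSpace ℝ (Fin n)) 1).indicator
        (fun u ↦ gaussDensity n (A • (u - e))) u := by
    intro u
    have : ‖A • u‖ ≤ A ↔ ‖u‖ ≤ 1 := by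
      rw [norm_smul, Real.norm_of_nonneg hA.le, mul_le_iff_le_one_right hA]
    by_cases hu : ‖u‖ ≤ 1
    · rw [Set.indicator_of_mem (by simpa using this.2 hu), Set.indicator_of_mem (by simpa using hu),
        smul_sub, mul_one]
    · rw [Set.indicator_of_notMem (by simpa using fun h ↦ hu (this.1 h)),
        Set.indicator_of_notMem (by simpa using hu), mul_zero]
  simp_rw [h4] at h3
  rw [h3, finrank_euclideanSpace_fin, abs_of_pos (by positivity), smul_eq_mul, ← mul_assoc,
    mul_inv_cancel₀ (by positivity), one_mul]

theorem continuousOn_one_sub_marcumQ (hn : 2 ≤ n) :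
    ContinuousOn (fun A ↦ 1 - marcumQ n A A) (Set.Ioi 0) := by
  obtain ⟨e, he⟩ := exists_euclidean_norm_eq hn zero_le_one
  have hc : Continuous fun A : ℝ ↦
      A ^ n * ∫ u in Metric.closedBall (0 : EuclideanSpace ℝ (Fin n)) 1,
        gaussDensity n (A • (u - e)) := by
    refine (continuous_id.pow n).mul ?_
    exact continuous_parametric_integral_of_continuous
      (f := fun A u ↦ gaussDensity n (A • (u - e)))
      ((continuous_gaussDensity n).comp (by fun_prop)) (isCompact_closedBall _ _)
  exact hc.continuousOn.congr fun A hA ↦ one_sub_marcumQ_smul hn he hA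

theorem continuousOn_betaLower (hn : 2 ≤ n) : ContinuousOn (betaLower n) (Set.Ioi 0) := by
  have hV : ContinuousOn (ballVol n) (Set.Ioi 0) := by
    refine ContinuousOn.congr (f := fun A ↦ A ^ n * ballVol n 1) (by fun_prop) fun A hA ↦ ?_
    exact ballVol_eq (le_of_lt hA)
  unfold betaLower
  have hk := (continuous_kConst (n := n) (by omega)).continuousOn (s := Set.Ioi 0)
  refine hV.div ((continuousOn_const.mul hk).add hV) fun A hA ↦ ?_
  have := ballVol_pos (n := n) hA
  have := kConst_pos hn (le_of_lt hA)
  positivity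

/-- On the unit ball `‖u - e‖ ≤ 2`, so the Gaussian exponent is at least `-(2 A)² / 2`. -/
theorem ballVol_mul_le_one_sub_marcumQ (hn : 2 ≤ n) {A : ℝ} (hA : 0 < A) :
    ballVol n A * ((2 * Real.pi) ^ (-(n : ℝ) / 2) * Real.exp (-(2 * A ^ 2))) ≤
      1 - marcumQ n A A := by
  obtain ⟨e, he⟩ := exists_euclidean_norm_eq hn zero_le_one
  rw [one_sub_marcumQ_smul hn he hA, ballVol_eq hA.le, mul_assoc]
  refine mul_le_mul_of_nonneg_left ?_ (by positivity)
  have h := setIntegral_mono_on (μ := volume)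
    (s := Metric.closedBall (0 : EuclideanSpace ℝ (Fin n)) 1)
    (f := fun _ ↦ (2 * Real.pi) ^ (-(n : ℝ) / 2) * Real.exp (-(2 * A ^ 2)))
    (g := fun u ↦ gaussDensity n (A • (u - e)))
    (integrableOn_const measure_closedBall_lt_top.ne)
    (((continuous_gaussDensity n).comp (by fun_prop)).continuousOn.integrableOn_compact
      (isCompact_closedBall _ _)) measurableSet_closedBall fun u hu ↦ ?_
  · rw [setIntegral_const, smul_eq_mul] at h
    exact h
  · have hu1 : ‖u‖ ≤ 1 := by simpa using hu
    have hue : ‖u - e‖ ≤ 2 := (norm_sub_le _ _).trans (by linarith)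
    have h2 : ‖A • (u - e)‖ ^ 2 ≤ 4 * A ^ 2 := by
      rw [norm_smul, mul_pow, Real.norm_eq_abs, sq_abs]
      have : ‖u - e‖ ^ 2 ≤ 2 ^ 2 := by gcongr
      nlinarith [sq_nonneg A]
    unfold gaussDensity
    gcongr
    linarith

theorem exists_betaLower_lt (hn : 2 ≤ n) :
    ∃ ε > 0, ∀ A, 0 < A → A < ε → betaLower n A < 1 - marcumQ n A A := by
  obtain ⟨c, hc, hk⟩ := exists_pos_add_mul_le_kConst hn
  -- The bound `1 / 2` keeps `2 A² ≤ 1`, so that `exp (2 A²) ≤ 1 + 4 A²`; the bound `c / 4` gives `4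
  -- A² ≤ c A`.
  refine ⟨min (1 / 2) (c / 4), by positivity, fun A hA hAε ↦ ?_⟩
  have hA1 : A < 1 / 2 := hAε.trans_le (min_le_left _ _)
  have hA2 : A < c / 4 := hAε.trans_le (min_le_right _ _)
  refine lt_of_lt_of_le ?_ (ballVol_mul_le_one_sub_marcumQ hn hA)
  have hV := ballVol_pos (n := n) hA
  have hkA := hk A hA.le
  have hexp : Real.exp (2 * A ^ 2) ≤ kConst n A := by
    have h1 := Real.abs_exp_sub_one_le (x := 2 * A ^ 2) (by
      rw [abs_of_nonneg (by positivity)]; nlinarith)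
    rw [abs_of_nonneg (a := 2 * A ^ 2) (by positivity)] at h1
    have := (abs_le.1 h1).2
    nlinarith
  have hkpos : 0 < kConst n A := (Real.exp_pos _).trans_le hexp
  rw [betaLower, div_eq_mul_inv]
  refine mul_lt_mul_of_pos_left ?_ hV
  rw [neg_div, Real.rpow_neg (by positivity), Real.exp_neg, ← mul_inv]
  refine inv_strictAnti₀ (by positivity) ?_
  have : (2 * Real.pi) ^ ((n : ℝ) / 2) * Real.exp (2 * A ^ 2) ≤
    (2 * Real.pi) ^ ((n : ℝ) / 2) * kConst n A := by gcongr
  linarith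

/-- The volume grows like `A ^ n` and `kConst` at most like `A ^ (n - 1)`, so for large `A` the
right side of (*) exceeds `1/2`. -/
theorem exists_lt_betaLower (hn : 2 ≤ n) : ∃ A > 0, 1 - marcumQ n A A < betaLower n A := by
  obtain ⟨D, hD⟩ := exists_kConst_le (n := n) (by omega)
  have hV1 := ballVol_pos (n := n) one_pos
  -- Large enough for `Vol(1) A ^ n` to beat `(2π)^{n/2} D A ^ (n - 1)`; the `1` makes the bound
  -- with `D` available.
  set A := max 1 ((2 * Real.pi) ^ ((n : ℝ) / 2) * D / ballVol n 1 + 1) with hAdef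
  have hA1 : 1 ≤ A := le_max_left _ _
  have hA0 : 0 < A := by linarith
  have hA2 : (2 * Real.pi) ^ ((n : ℝ) / 2) * D < A * ballVol n 1 := by
    rw [← div_lt_iff₀ hV1]
    exact (lt_add_one _).trans_le (le_max_right _ _)
  refine ⟨A, hA0, (one_sub_marcumQ_le_half hn hA0.le).trans_lt ?_⟩
  have hV := ballVol_pos (n := n) hA0
  have hk := kConst_pos hn hA0.le
  have hlt : (2 * Real.pi) ^ ((n : ℝ) / 2) * kConst n A < ballVol n A := by
    calc _ ≤ (2 * Real.pi) ^ ((n : ℝ) / 2) * (D * A ^ (n - 1)) := by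
          gcongr
          exact hD A hA1
      _ = ((2 * Real.pi) ^ ((n : ℝ) / 2) * D) * A ^ (n - 1) := by ring
      _ < (A * ballVol n 1) * A ^ (n - 1) := by gcongr
      _ = (A * A ^ (n - 1)) * ballVol n 1 := by ring
      _ = ballVol n A := by
          rw [← pow_succ', Nat.sub_add_cancel (by omega), ballVol_eq hA0.le]
  rw [betaLower, lt_div_iff₀ (by positivity)]
  linarith

/-- Positivity on `(0, ε)` keeps the zeros away from `0`, so those up to `B` form a compact set with
a least element. A negative value before it would force an earlier zero. -/
theorem exists_isLeast_zero {d : ℝ → ℝ} (hd : ContinuousOn d (Set.Ioi 0))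
    (h0 : ∃ ε > 0, ∀ A, 0 < A → A < ε → 0 < d A) (h1 : ∃ A > 0, d A < 0) :
    ∃ Astar, IsLeast {A | 0 < A ∧ d A = 0} Astar ∧ ∀ A, 0 < A → A ≤ Astar → 0 ≤ d A := by
  obtain ⟨ε, hε, hpos⟩ := h0
  obtain ⟨B, hB, hneg⟩ := h1
  have hzero : ∀ A, 0 < A → d A < 0 → ∃ z ∈ Set.Icc (ε / 2) A, d z = 0 := by
    intro A hA hdA
    have hεA : ε ≤ A := by
      by_contra! h
      exact (hpos A hA h).not_gt hdA
    refine intermediate_value_Icc' (by linarith)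
      (hd.mono fun x hx ↦ lt_of_lt_of_le (by positivity) hx.1) ⟨hdA.le, ?_⟩
    exact (hpos _ (by positivity) (by linarith)).le
  have hcomp : IsCompact (Set.Icc (ε / 2) B ∩ d ⁻¹' {0}) :=
    isCompact_Icc.of_isClosed_subset ((hd.mono fun x hx ↦
      lt_of_lt_of_le (by positivity) hx.1).preimage_isClosed_of_isClosed isClosed_Icc
      isClosed_singleton) Set.inter_subset_left
  obtain ⟨z, hz, hdz⟩ := hzero B hB hneg
  obtain ⟨S, hS, hmin⟩ := hcomp.exists_isLeast ⟨z, hz, hdz⟩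
  have hS0 : 0 < S := lt_of_lt_of_le (by positivity) hS.1.1
  have hleast : IsLeast {A | 0 < A ∧ d A = 0} S := by
    refine ⟨⟨hS0, hS.2⟩, fun A ⟨hA, hdA⟩ ↦ ?_⟩
    rcases le_or_gt A B with hAB | hAB
    · refine hmin ⟨⟨?_, hAB⟩, hdA⟩
      by_contra! h
      exact (hpos A hA (by linarith)).ne' hdA
    · exact hS.1.2.trans hAB.le
  refine ⟨S, hleast, fun A hA hAS ↦ ?_⟩
  by_contra! h
  obtain ⟨w, hw, hdw⟩ := hzero A hA h
  have hSw : S ≤ w := hleast.2 ⟨lt_of_lt_of_le (by positivity) hw.1, hdw⟩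
  -- The earlier zero cannot precede `S`, so `A` is `S` itself, where `d` vanishes and is not
  -- negative.
  have : A = S := le_antisymm hAS (hSw.trans hw.2)
  rw [this] at h
  exact h.ne hS.2

end Threshold

theorem mainTheorem6 (n : ℕ) (hn : 2 ≤ n) :
    ∃ Astar : ℝ,
      IsLeast {A : ℝ | 0 < A ∧ 1 - marcumQ n A A = betaLower n A} Astar ∧
      (∀ A : ℝ, 0 < A → A ≤ Astar → betaLower n A ≤ 1 - marcumQ n A A) ∧
      (∀ P : ℝ, 0 < P → betaLower n √(n * P) ≤ betaN n P →
        ((capacity n √(n * P) : ℝ≥0∞) : EReal) ≤ (refinedBound n P : EReal)) ∧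
      (∀ P : ℝ, 0 < P → P ≤ Astar ^ 2 / n →
        ((capacity n √(n * P) : ℝ≥0∞) : EReal) ≤ (refinedBound n P : EReal)) := by
  have hn0 : (0 : ℝ) < n := by positivity
  obtain ⟨S, hS, hle⟩ := exists_isLeast_zero
    (d := fun A ↦ 1 - marcumQ n A A - betaLower n A)
    ((continuousOn_one_sub_marcumQ hn).sub (continuousOn_betaLower hn))
    (by simpa only [sub_pos] using exists_betaLower_lt hn)
    (by simpa only [sub_neg] using exists_lt_betaLower hn)
  simp only [sub_nonneg] at hle
  have hbound : ∀ P : ℝ, 0 < P → betaLower n √(n * P) ≤ betaN n P →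
      ((capacity n √(n * P) : ℝ≥0∞) : EReal) ≤ (refinedBound n P : EReal) :=
    fun P hP h ↦ capacity_le_of_betaLower_le hn (Real.sqrt_pos.2 (mul_pos hn0 hP)) h
  refine ⟨S, ?_, hle, hbound, fun P hP hPS ↦ hbound P hP (hle _ (by positivity) ?_)⟩
  · simpa only [sub_eq_zero] using hS
  · rw [le_div_iff₀ hn0] at hPS
    exact Real.sqrt_le_iff.2 ⟨hS.1.1.le, by linarith⟩
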